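/- Let $\ell\in\{\frac12,\frac32,\frac52,\dots\}$ and let $\mathfrak g^{\ell}$ be the Lie algebra with basis $C,D,H,M,P_0,\dots,P_{2\ell}$ and non-zero brackets $[D,H]=2H$, $[D,C]=-2C$, $[C,H]=D$, $[H,P_n]=-nP_{n-1}$, $[D,P_n]=2(\ell-n)P_n$, $[C,P_n]=(2\ell-n)P_{n+1}$, $[P_k,P_n]=\delta_{k+n,2\ell}\,I_k\,M$, where $I_k=(-1)^{k+\ell+\frac12}\,k!\,(2\ell-k)!$. For real $\delta,\mu$ let $V^{\delta,\mu}$ be the Verma module generated by a highest weight vector $|\delta,\mu\rangle$ with $D|\delta,\mu\rangle=\delta|\delta,\mu\rangle$, $M|\delta,\mu\rangle=\mu|\delta,\mu\rangle$ and $H|\delta,\mu\rangle=P_n|\delta,\mu\rangle=0$ for $0\le n\le\ell-\frac12$. Let $(\cdot,\cdot)$ be the Shapovalov form on $V^{\delta,\mu}$, that is, the sesquilinear form with $(|\delta,\mu\rangle,|\delta,\mu\rangle)=1$ and $(Ax,y)=(x,\omega(A)y)$ for all $A\in\mathfrak g^{\ell}$, where $\omega$ is the anti-automorphism with $\omega(P_j)=P_{2\ell-j}$,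 $\omega(C)=H$, $\omega(H)=C$, $\omega(D)=D$, $\omega(M)=M$ (extended conjugate-linearly). For $m\ge 0$ let $\mathcal D^{\ell}_m$, the Kac determinant at level $m$, be the determinant of the Gram matrix of this form on the vectors $C^{h}\prod_{j=0}^{\ell-1/2}P_{\ell+\frac12+j}^{k_j}|\delta,\mu\rangle$ with $h,k_0,\dots,k_{\ell-1/2}\in\mathbb Z_{\ge0}$ and $2h+\sum_{j}(2j+1)k_j=m$. Define $d^{\ell}_m,e^{\ell}_m$ by $$\sum_{m\ge0}d^{\ell}_mx^m=\frac1{1-x^2}\prod_{j=0}^{\ell-\frac12}\frac1{1-x^{2j+1}},\qquad \sum_{m\ge0}e^{\ell}_mx^m=\Bigl(\sum_{i=0}^{\ell-\frac12}\frac{x^{2i+1}}{1-x^{2i+1}}\Bigr)\frac1{1-x^2}\prod_{j=0}^{\ell-\frac12}\frac1{1-x^{2j+1}}.$$ Then for every $\ell$ and $m$ there is a constant $C^{\ell}_m\neq0$, depending only on $\ell$ and $m$, such that for all real $\delta,\mu$ the form exists and $$\mathcal D^{\ell}_m=C^{\ell}_m\,\mu^{e^{\ell}_m}\prod_{j=0}^{\lfloor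 m/2\rfloor-1}\Bigl(2\delta-2j+\bigl(\ell+\tfrac12\bigr)^2\Bigr)^{d^{\ell}_{m-2(j+1)}}.$$ In particular, for $\ell=\frac12$ (the Schrödinger algebra), $$\mathcal D^{1/2}_m=C^{1/2}_m\,\mu^{(m-\lfloor m/2\rfloor)(\lfloor m/2\rfloor+1)}\prod_{j=0}^{\lfloor m/2\rfloor-1}(2\delta-2j+1)^{\lfloor m/2\rfloor-j},$$ the form conjectured by Dobrev, Doebner and Mrugalla. -/

import Mathlib

open scoped ComplexConjugate

noncomputable section

namespace ConformalGalilei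

/-- The half-integer spin `ℓ = L + 1/2`. The parameter `L : ℕ` enumerates
`ℓ = 1/2, 3/2, 5/2, …`; thus `2ℓ = 2L + 1`, `ℓ - 1/2 = L` and `ℓ + 1/2 = L + 1`. -/
def spin (L : ℕ) : ℝ := (L : ℝ) + 1 / 2

/-- The basis `C, D, H, M, P₀, …, P_{2ℓ}` of the centrally extended algebra. -/
inductive Gen (L : ℕ) : Type
  | C : Gen L
  | D : Gen L
  | H : Gen L
  | M : Gen L
  | P : Fin (2 * L + 2) → Gen L

/-- The complex vector space with basis `C, D, H, M, P₀, …, P_{2ℓ}`. -/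
def CGA (L : ℕ) : Type := Gen L →₀ ℂ

instance (L : ℕ) : AddCommGroup (CGA L) := inferInstanceAs (AddCommGroup (Gen L →₀ ℂ))

instance (L : ℕ) : Module ℂ (CGA L) := inferInstanceAs (Module ℂ (Gen L →₀ ℂ))

/-- A generator as an element of the algebra. -/
def gen {L : ℕ} (a : Gen L) : CGA L := Finsupp.single a (1 : ℂ)

/-- `P_n` as an element of the algebra, with `P_n = 0` for `n > 2ℓ`. -/
def pVec (L n : ℕ) : CGA L :=
  if h : n < 2 * L + 2 then gen (Gen.P ⟨n, h⟩) else 0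

/-- The structure constant `I_m = (-1)^(m + ℓ + 1/2) m! (2ℓ - m)!`, for `0 ≤ m ≤ 2ℓ`. -/
def structI (L m : ℕ) : ℂ :=
  (-1) ^ (m + L + 1) * (Nat.factorial m : ℂ) * (Nat.factorial (2 * L + 1 - m) : ℂ)

/-- The brackets of the basis elements. -/
def bracketGen (L : ℕ) : Gen L → Gen L → CGA L
  | .D, .H => (2 : ℂ) • gen .H
  | .H, .D => -((2 : ℂ) • gen .H)
  | .D, .C => (-2 : ℂ) • gen .C
  | .C, .D => -((-2 : ℂ) • gen .C)
  | .C, .H => gen .D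
  | .H, .C => -gen .D
  | .H, .P n => (-((n : ℕ) : ℂ)) • pVec L ((n : ℕ) - 1)
  | .P n, .H => -((-((n : ℕ) : ℂ)) • pVec L ((n : ℕ) - 1))
  | .D, .P n => (2 * ((spin L : ℂ) - ((n : ℕ) : ℂ))) • gen (.P n)
  | .P n, .D => -((2 * ((spin L : ℂ) - ((n : ℕ) : ℂ))) • gen (.P n))
  | .C, .P n => (2 * (spin L : ℂ) - ((n : ℕ) : ℂ)) • pVec L ((n : ℕ) + 1)
  | .P n, .C => -((2 * (spin L : ℂ) - ((n : ℕ) : ℂ)) • pVec L ((n : ℕ) + 1))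
  | .P m, .P n => if (m : ℕ) + (n : ℕ) = 2 * L + 1 then structI L (m : ℕ) • gen .M else 0
  | .C, .C => 0
  | .D, .D => 0
  | .H, .H => 0
  | .M, _ => 0
  | _, .M => 0

/-- The bilinear extension of the brackets of the basis elements. -/
def bracketMap (L : ℕ) : CGA L →ₗ[ℂ] CGA L →ₗ[ℂ] CGA L :=
  Finsupp.linearCombination ℂ fun a : Gen L =>
    (Finsupp.linearCombination ℂ (bracketGen L a) : (Gen L →₀ ℂ) →ₗ[ℂ] CGA L)

theorem bracketMap_gen {L : ℕ} (a b : Gen L) :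
    bracketMap L (gen a) (gen b) = bracketGen L a b := by
  unfold bracketMap gen
  erw [Finsupp.linearCombination_single, one_smul, Finsupp.linearCombination_single, one_smul]

theorem induction_gen {L : ℕ} {p : CGA L → Prop} (h0 : p 0)
    (hadd : ∀ x y, p x → p y → p (x + y)) (hgen : ∀ (c : ℂ) (a : Gen L), p (c • gen a))
    (x : CGA L) : p x := by
  refine Finsupp.induction_linear (motive := p) x h0 hadd fun a c => ?_
  have h : (Finsupp.single a c : CGA L) = c • gen a := by
    unfold gen
    erw [Finsupp.smul_single]
    simp
  exact h ▸ hgen c a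

theorem bracketGen_antisymm {L : ℕ} (a b : Gen L) :
    bracketGen L a b = - bracketGen L b a := by
  cases a <;> cases b <;> simp only [bracketGen, neg_neg, neg_zero]
  rename_i m n
  by_cases h : (m : ℕ) + (n : ℕ) = 2 * L + 1
  · have h' : (n : ℕ) + (m : ℕ) = 2 * L + 1 := by omega
    rw [if_pos h, if_pos h', ← neg_smul]
    congr 1
    have e1 : 2 * L + 1 - (m : ℕ) = n := by omega
    have e2 : 2 * L + 1 - (n : ℕ) = m := by omega
    have e3 : (-1 : ℂ) ^ ((m : ℕ) + L + 1) = - (-1) ^ ((n : ℕ) + L + 1) := by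
      have h3 : (-1 : ℂ) ^ ((m : ℕ) + L + 1) * (-1) ^ ((n : ℕ) + L + 1) = -1 := by
        rw [← pow_add]
        exact Odd.neg_one_pow ⟨2 * L + 1, by omega⟩
      rcases neg_one_pow_eq_or ℂ ((n : ℕ) + L + 1) with h4 | h4 <;> rw [h4] at h3 ⊢
      · simpa using h3
      · linear_combination -h3
    unfold structI
    rw [e1, e2, e3]
    ring
  · have h' : ¬ ((n : ℕ) + (m : ℕ) = 2 * L + 1) := by omega
    rw [if_neg h, if_neg h', neg_zero]

theorem bracketMap_antisymm {L : ℕ} (x y : CGA L) : bracketMap L x y = - bracketMap L y x := by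
  induction x using induction_gen with
  | h0 => simp
  | hadd x x' hx hx' => simp [hx, hx']; abel
  | hgen c a =>
    induction y using induction_gen with
    | h0 => simp
    | hadd y y' hy hy' => rw [map_add, hy, hy']; simp; abel
    | hgen d b =>
      simp only [map_smul, LinearMap.smul_apply, bracketMap_gen]
      rw [bracketGen_antisymm a b, smul_comm]; simp

theorem gen_P {L : ℕ} (n : Fin (2 * L + 2)) : gen (Gen.P n) = pVec L (n : ℕ) := by
  simp [pVec]

theorem D_pVec (L n : ℕ) : bracketMap L (gen .D) (pVec L n) =
    (2 * ((spin L : ℂ) - (n : ℂ))) • pVec L n := by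
  by_cases h : n < 2 * L + 2
  · simp [pVec, h, bracketMap_gen, bracketGen]
  · simp [pVec, h]

theorem C_pVec (L n : ℕ) : bracketMap L (gen .C) (pVec L n) =
    (2 * (spin L : ℂ) - (n : ℂ)) • pVec L (n + 1) := by
  by_cases h : n < 2 * L + 2
  · simp [pVec, h, bracketMap_gen, bracketGen]
  · have h' : ¬ (n + 1 < 2 * L + 2) := by omega
    simp [pVec, h, h']

theorem H_pVec (L n : ℕ) (h : n < 2 * L + 2) : bracketMap L (gen .H) (pVec L n) =
    (-(n : ℂ)) • pVec L (n - 1) := by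
  simp [pVec, h, bracketMap_gen, bracketGen]

theorem M_left (L : ℕ) (x : CGA L) : bracketMap L (gen .M) x = 0 := by
  induction x using induction_gen with
  | h0 => simp
  | hadd y y' hy hy' => simp [hy, hy']
  | hgen d b => simp [bracketMap_gen, bracketGen]

theorem pVec_pVec (L m n : ℕ) : bracketMap L (pVec L m) (pVec L n) =
    if m + n = 2 * L + 1 then structI L m • gen .M else 0 := by
  by_cases h : m < 2 * L + 2
  · by_cases h' : n < 2 * L + 2
    · simp [pVec, h, h', bracketMap_gen, bracketGen]
    · have h3 : ¬ (m + n = 2 * L + 1) := by omega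
      simp [pVec, h', h3]
  · have h3 : ¬ (m + n = 2 * L + 1) := by omega
    simp [pVec, h, h3]

theorem spin_two (L : ℕ) : 2 * (spin L : ℂ) = 2 * L + 1 := by
  simp [spin]; ring

/-- The Jacobi identity, as a property of a triple. -/
def Jac {L : ℕ} (x y z : CGA L) : Prop :=
  bracketMap L x (bracketMap L y z) =
    bracketMap L (bracketMap L x y) z + bracketMap L y (bracketMap L x z)

theorem Jac.swap12 {L : ℕ} {x y z : CGA L} (h : Jac x y z) : Jac y x z := by
  unfold Jac at *
  rw [h, bracketMap_antisymm y x]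
  simp

theorem Jac.swap23 {L : ℕ} {x y z : CGA L} (h : Jac x y z) : Jac x z y := by
  unfold Jac at *
  rw [bracketMap_antisymm z y, map_neg, h, bracketMap_antisymm (bracketMap L x z) y,
    bracketMap_antisymm z (bracketMap L x y)]
  abel

theorem jac_M {L : ℕ} (y z : CGA L) : Jac (gen .M) y z := by
  simp [Jac, M_left]

theorem bracketMap_self {L : ℕ} (x : CGA L) : bracketMap L x x = 0 := by
  have h := bracketMap_antisymm x x
  have h2 : (2 : ℂ) • bracketMap L x x = 0 := by
    rw [two_smul]; nth_rewrite 1 [h]; simp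
  exact (smul_eq_zero.mp h2).resolve_left two_ne_zero

theorem jac_self {L : ℕ} (x z : CGA L) : Jac x x z := by
  simp [Jac, bracketMap_self]

theorem jac_CDH {L : ℕ} : Jac (gen .C : CGA L) (gen .D) (gen .H) := by
  simp [Jac, bracketMap_gen, bracketGen]

theorem jac_CDP {L : ℕ} (n : ℕ) : Jac (gen .C : CGA L) (gen .D) (pVec L n) := by
  unfold Jac
  simp only [D_pVec, C_pVec, bracketMap_gen, bracketGen, map_smul, map_neg, LinearMap.smul_apply,
    LinearMap.neg_apply]
  push_cast
  module

theorem jac_CHP {L : ℕ} (n : ℕ) (hn : n < 2 * L + 2) :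
    Jac (gen .C : CGA L) (gen .H) (pVec L n) := by
  unfold Jac
  rw [H_pVec L n hn, C_pVec, bracketMap_gen, bracketGen, map_smul, map_smul, D_pVec, C_pVec]
  have e1 : (-(n : ℂ)) • (2 * (spin L : ℂ) - ((n - 1 : ℕ) : ℂ)) • pVec L (n - 1 + 1) =
      (-(n : ℂ) * (2 * (spin L : ℂ) - (n : ℂ) + 1)) • pVec L n := by
    rcases n with _ | n
    · simp
    · simp only [Nat.add_sub_cancel]; push_cast; module
  have e2 : (2 * (spin L : ℂ) - (n : ℂ)) • bracketMap L (gen .H) (pVec L (n + 1)) =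
      ((2 * (spin L : ℂ) - (n : ℂ)) * (-((n : ℂ) + 1))) • pVec L n := by
    by_cases h : n + 1 < 2 * L + 2
    · rw [H_pVec L _ h, Nat.add_sub_cancel]; push_cast; module
    · have h' : n = 2 * L + 1 := by omega
      have h0 : 2 * (spin L : ℂ) - (n : ℂ) = 0 := by rw [spin_two, h']; push_cast; ring
      rw [h0]; simp
  rw [e1, e2]
  module

theorem jac_DHP {L : ℕ} (n : ℕ) (hn : n < 2 * L + 2) :
    Jac (gen .D : CGA L) (gen .H) (pVec L n) := by
  unfold Jac
  rw [H_pVec L n hn, D_pVec, bracketMap_gen, bracketGen, map_smul, map_smul, D_pVec, map_smul,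
    LinearMap.smul_apply, H_pVec L n hn]
  rcases n with _ | n
  · simp
  · simp only [Nat.add_sub_cancel]; push_cast; module

theorem M_right (L : ℕ) (x : CGA L) : bracketMap L x (gen .M) = 0 := by
  rw [bracketMap_antisymm, M_left, neg_zero]

theorem jac_DPP {L : ℕ} (m n : ℕ) : Jac (gen .D : CGA L) (pVec L m) (pVec L n) := by
  unfold Jac
  simp only [D_pVec, map_smul, LinearMap.smul_apply, pVec_pVec]
  by_cases h : m + n = 2 * L + 1
  · have hc : (m : ℂ) + n = 2 * L + 1 := by exact_mod_cast h
    simp only [h, if_true, map_smul, M_right, smul_smul, ← add_smul]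
    rw [smul_zero, eq_comm]
    convert zero_smul ℂ _ using 2
    linear_combination (-2 * structI L m) * hc + (2 * structI L m) * spin_two L
  · simp [h]

theorem structI_succ (L m : ℕ) (hm : m ≤ 2 * L) :
    ((2 * L + 1 - m : ℕ) : ℂ) * structI L (m + 1) = -((m : ℂ) + 1) * structI L m := by
  have e1 : 2 * L + 1 - m = (2 * L - m) + 1 := by omega
  have e2 : 2 * L + 1 - (m + 1) = 2 * L - m := by omega
  unfold structI
  rw [e1, e2, Nat.factorial_succ, Nat.factorial_succ]
  push_cast
  ring

theorem jac_CPP {L : ℕ} (m n : ℕ) :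
    Jac (gen .C : CGA L) (pVec L m) (pVec L n) := by
  unfold Jac
  simp only [C_pVec, map_smul, LinearMap.smul_apply, pVec_pVec]
  have h1 : bracketMap L (gen .C) (if m + n = 2 * L + 1 then structI L m • gen .M else 0) = 0 := by
    split_ifs <;> simp [M_right]
  rw [h1]
  by_cases h : m + n = 2 * L
  · have hc : (m : ℂ) + n = 2 * L := by exact_mod_cast h
    rw [if_pos (by omega), if_pos (by omega), smul_smul, smul_smul, ← add_smul, eq_comm]
    convert zero_smul ℂ _ using 2
    have h2 := structI_succ L m (by omega)
    have h3 : ((2 * L + 1 - m : ℕ) : ℂ) = 2 * L + 1 - m := by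
      rw [Nat.cast_sub (by omega)]; push_cast; ring
    rw [h3] at h2
    rw [spin_two]
    linear_combination h2 - structI L m * hc
  · rw [if_neg (by omega), if_neg (by omega)]; simp

theorem jac_HPP {L : ℕ} (m n : ℕ) (hm : m < 2 * L + 2) (hn : n < 2 * L + 2) :
    Jac (gen .H : CGA L) (pVec L m) (pVec L n) := by
  unfold Jac
  rw [H_pVec L m hm, H_pVec L n hn]
  simp only [map_smul, LinearMap.smul_apply, pVec_pVec]
  have h1 : bracketMap L (gen .H) (if m + n = 2 * L + 1 then structI L m • gen .M else 0) = 0 := by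
    split_ifs <;> simp [M_right]
  rw [h1]
  by_cases h : m + n = 2 * L + 2
  · have hc : (m : ℂ) + n = 2 * L + 2 := by exact_mod_cast h
    rw [if_pos (by omega), if_pos (by omega), smul_smul, smul_smul, ← add_smul, eq_comm]
    convert zero_smul ℂ _ using 2
    obtain ⟨k, rfl⟩ : ∃ k, m = k + 1 := ⟨m - 1, by omega⟩
    have h2 := structI_succ L k (by omega)
    have h3 : 2 * L + 1 - k = n := by omega
    rw [h3] at h2
    simp only [Nat.add_sub_cancel]
    push_cast
    linear_combination -h2
  · have z1 : (-(m : ℂ)) • (if m - 1 + n = 2 * L + 1 then structI L (m - 1) • gen .M else 0) =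
        (0 : CGA L) := by
      rcases m with _ | m
      · simp
      · rw [if_neg (by omega), smul_zero]
    have z2 : (-(n : ℂ)) • (if m + (n - 1) = 2 * L + 1 then structI L m • gen .M else 0) =
        (0 : CGA L) := by
      rcases n with _ | n
      · simp
      · rw [if_neg (by omega), smul_zero]
    rw [z1, z2, add_zero]

theorem jac_PPP {L : ℕ} (k m n : ℕ) : Jac (pVec L k) (pVec L m) (pVec L n) := by
  unfold Jac
  simp only [pVec_pVec]
  split_ifs <;> simp [M_left, M_right]

theorem jac_gen {L : ℕ} (a b c : Gen L) : Jac (gen a) (gen b) (gen c) := by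
  have r (x y z : CGA L) (h : Jac x y z) : Jac y z x := h.swap12.swap23
  have m1 (y z : CGA L) : Jac y (gen .M) z := (jac_M y z).swap12
  have m2 (y z : CGA L) : Jac y z (gen .M) := (m1 y z).swap23
  have s1 (x z : CGA L) : Jac x z x := (jac_self x z).swap23
  have s2 (x z : CGA L) : Jac z x x := (s1 x z).swap12
  have perm (x y z : CGA L) (h : Jac x y z) :
      Jac x z y ∧ Jac y x z ∧ Jac y z x ∧ Jac z x y ∧ Jac z y x :=
    ⟨h.swap23, h.swap12, h.swap12.swap23, h.swap23.swap12, h.swap23.swap12.swap23⟩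
  have q0 := perm _ _ _ (jac_CDH (L := L))
  have q1 (n : ℕ) := perm _ _ _ (jac_CDP (L := L) n)
  have q2 (n : Fin (2 * L + 2)) := perm _ _ _ (jac_CHP (L := L) n n.2)
  have q3 (n : Fin (2 * L + 2)) := perm _ _ _ (jac_DHP (L := L) n n.2)
  have q4 (m n : Fin (2 * L + 2)) := perm _ _ _ (jac_CPP (L := L) m n)
  have q5 (m n : Fin (2 * L + 2)) := perm _ _ _ (jac_HPP (L := L) m n m.2 n.2)
  have q6 (m n : Fin (2 * L + 2)) := perm _ _ _ (jac_DPP (L := L) m n)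
  cases a <;> cases b <;> cases c <;>
    simp only [gen_P, jac_M, m1, m2, jac_self, s1, s2, q0, q1, q2, q3, q4, q5, q6, jac_CDH,
      jac_CDP, jac_CHP, jac_DHP, jac_PPP, Fin.is_lt]

theorem bracketMap_jacobi_gen {L : ℕ} (a b c : Gen L) :
    bracketMap L (gen a) (bracketGen L b c) =
      bracketMap L (bracketGen L a b) (gen c) + bracketMap L (gen b) (bracketGen L a c) := by
  have h := jac_gen a b c
  simpa only [Jac, bracketMap_gen] using h

theorem bracketMap_jacobi {L : ℕ} (x y z : CGA L) :
    bracketMap L x (bracketMap L y z) =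
      bracketMap L (bracketMap L x y) z + bracketMap L y (bracketMap L x z) := by
  induction x using induction_gen with
  | h0 => simp
  | hadd x x' hx hx' => simp only [map_add, LinearMap.add_apply, hx, hx']; abel
  | hgen c a =>
    induction y using induction_gen with
    | h0 => simp
    | hadd y y' hy hy' => simp only [map_add, LinearMap.add_apply, hy, hy']; abel
    | hgen d b =>
      induction z using induction_gen with
      | h0 => simp
      | hadd z z' hz hz' => simp only [map_add, hz, hz']; abel
      | hgen e f =>
        simp only [map_smul, LinearMap.smul_apply, bracketMap_gen]
        rw [bracketMap_jacobi_gen]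
        module

/-- The centrally extended conformal Galilei algebra of spin `ℓ` in one space dimension. -/
instance (L : ℕ) : LieRing (CGA L) where
  bracket x y := bracketMap L x y
  add_lie x y z := by simp
  lie_add x y z := by simp
  lie_self x := bracketMap_self x
  leibniz_lie x y z := bracketMap_jacobi x y z

instance (L : ℕ) : LieAlgebra ℂ (CGA L) where
  lie_smul c x y := by simp [Bracket.bracket]

/-- The universal enveloping algebra. -/
abbrev U (L : ℕ) : Type := UniversalEnvelopingAlgebra ℂ (CGA L)

/-- The canonical map of the Lie algebra into its universal enveloping algebra. -/
def toU {L : ℕ} (x : CGA L) : U L := UniversalEnvelopingAlgebra.ι ℂ x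

/-- The left ideal of the enveloping algebra generated by
`H, P₀, …, P_{ℓ - 1/2}`, `D - δ` and `M - μ`. -/
def vermaIdeal (L : ℕ) (δ μ : ℝ) : Ideal (U L) :=
  Ideal.span
    ({toU (gen .H)} ∪ {u | ∃ n : ℕ, n ≤ L ∧ u = toU (pVec L n)} ∪
      {toU (gen .D) - algebraMap ℂ (U L) (δ : ℂ), toU (gen .M) - algebraMap ℂ (U L) (μ : ℂ)})

/-- The Verma module with highest weight `(δ, μ)`. -/
abbrev Verma (L : ℕ) (δ μ : ℝ) : Type := U L ⧸ vermaIdeal L δ μ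

/-- The highest weight vector. -/
def hwv (L : ℕ) (δ μ : ℝ) : Verma L δ μ := Submodule.Quotient.mk 1

/-- `ω` on the basis: `P_j ↦ P_{2ℓ - j}`, `C ↦ H`, `H ↦ C`, `D ↦ D`, `M ↦ M`. -/
def omegaGen {L : ℕ} : Gen L → Gen L
  | .C => .H
  | .D => .D
  | .H => .C
  | .M => .M
  | .P j => .P (Fin.rev j)

/-- The involutive anti-automorphism `ω`, extended conjugate-linearly from the basis (as it has
to be for a form that is conjugate-linear in its first argument). -/
def omega {L : ℕ} (x : CGA L) : CGA L :=
  Finsupp.mapDomain omegaGen (Finsupp.mapRange (conj : ℂ → ℂ) (map_zero _) x)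

/-- A sesquilinear form on the Verma module is the Shapovalov form if the highest weight vector
has square `1` and the form is contravariant with respect to `ω`. -/
structure IsShapovalov {L : ℕ} {δ μ : ℝ}
    (B : Verma L δ μ →ₗ⋆[ℂ] Verma L δ μ →ₗ[ℂ] ℂ) : Prop where
  hwv_hwv : B (hwv L δ μ) (hwv L δ μ) = 1
  contravariant : ∀ (A : CGA L) (x y : Verma L δ μ),
    B (toU A • x) y = B x (toU (omega A) • y)

/-- The labels `(h, k₀, …, k_{ℓ - 1/2})` of level `m`, that is, with
`m = 2h + ∑ j, (2j + 1) k_j`. -/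
abbrev Label (L m : ℕ) : Type :=
  {a : ℕ × (Fin (L + 1) → ℕ) // 2 * a.1 + ∑ j : Fin (L + 1), (2 * (j : ℕ) + 1) * a.2 j = m}

instance (L m : ℕ) : Finite (Label L m) := by
  refine Finite.of_injective
    (fun a : Label L m =>
      ((⟨a.1.1, by have := a.2; omega⟩, fun j => ⟨a.1.2 j, ?_⟩) :
        Fin (m + 1) × (Fin (L + 1) → Fin (m + 1)))) ?_
  · have h1 := a.2
    have h2 := Finset.single_le_sum (f := fun j : Fin (L + 1) => (2 * (j : ℕ) + 1) * a.1.2 j)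
      (fun _ _ => Nat.zero_le _) (Finset.mem_univ j)
    have h3 : a.1.2 j ≤ (2 * (j : ℕ) + 1) * a.1.2 j := Nat.le_mul_of_pos_left _ (by omega)
    omega
  · rintro ⟨⟨h, k⟩, ha⟩ ⟨⟨h', k'⟩, ha'⟩ heq
    simp only [Prod.mk.injEq, Fin.mk.injEq, funext_iff] at heq
    have hk : k = k' := funext heq.2
    simp [heq.1, hk]

instance (L m : ℕ) : Fintype (Label L m) := Fintype.ofFinite _

/-- The basis vector
`C^h P_{ℓ+1/2}^{k₀} P_{ℓ+3/2}^{k₁} ⋯ P_{2ℓ}^{k_{ℓ-1/2}} |δ, μ⟩` of level `m`. -/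
def basisVec {L : ℕ} (δ μ : ℝ) {m : ℕ} (a : Label L m) : Verma L δ μ :=
  (toU (gen .C) ^ a.1.1 *
    (List.ofFn fun j : Fin (L + 1) => toU (pVec L (L + 1 + (j : ℕ))) ^ a.1.2 j).prod) •
      hwv L δ μ

/-- The Kac determinant at level `m`: the determinant of the Gram matrix of the form on the
basis vectors of level `m`. -/
def kacDet {L : ℕ} {δ μ : ℝ} (B : Verma L δ μ →ₗ⋆[ℂ] Verma L δ μ →ₗ[ℂ] ℂ) (m : ℕ) : ℂ :=
  (Matrix.of fun a b : Label L m => B (basisVec δ μ a) (basisVec δ μ b)).det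

/-- The power series `1 / (1 - x^k) = 1 + x^k + x^(2k) + ⋯` (for `k ≥ 1`). -/
def geomSeries (k : ℕ) : PowerSeries ℕ := PowerSeries.mk fun n => if k ∣ n then 1 else 0

/-- `geomSeries k` is the inverse of `1 - x^k`. -/
theorem one_sub_mul_geomSeries (k : ℕ) (hk : 0 < k) :
    (1 - PowerSeries.X ^ k) * PowerSeries.map (Nat.castRingHom ℤ) (geomSeries k) = 1 := by
  have h : PowerSeries.map (Nat.castRingHom ℤ) (geomSeries k) =
      1 + PowerSeries.X ^ k * PowerSeries.map (Nat.castRingHom ℤ) (geomSeries k) := by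
    ext n
    simp only [geomSeries, PowerSeries.coeff_map, PowerSeries.coeff_mk, map_add,
      PowerSeries.coeff_one, PowerSeries.coeff_X_pow_mul']
    rcases Nat.eq_zero_or_pos n with rfl | hn
    · simp [hk.ne']
    · by_cases hkn : k ≤ n
      · have : k ∣ n - k ↔ k ∣ n := by
          rw [Nat.dvd_sub_iff_left hkn (dvd_refl k)]
        simp [hn.ne', hkn, this]
      · have : ¬ k ∣ n := fun hd => hkn (Nat.le_of_dvd hn hd)
        simp [hn.ne', hkn, this]
  rw [sub_mul, one_mul]
  nth_rewrite 1 [h]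
  ring

/-- The generating function `(1 / (1 - x²)) ∏_{j=0}^{ℓ-1/2} 1 / (1 - x^(2j+1))` of `d^ℓ_m`. -/
def dSeries (L : ℕ) : PowerSeries ℕ :=
  geomSeries 2 * ∏ j ∈ Finset.range (L + 1), geomSeries (2 * j + 1)

/-- The generating function
`(∑_{i=0}^{ℓ-1/2} x^(2i+1) / (1 - x^(2i+1))) (1 / (1 - x²)) ∏_{j=0}^{ℓ-1/2} 1 / (1 - x^(2j+1))`
of `e^ℓ_m`. -/
def eSeries (L : ℕ) : PowerSeries ℕ :=
  (∑ i ∈ Finset.range (L + 1), PowerSeries.X ^ (2 * i + 1) * geomSeries (2 * i + 1)) *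
    (geomSeries 2 * ∏ j ∈ Finset.range (L + 1), geomSeries (2 * j + 1))

/-- The exponent `d^ℓ_m`. -/
def dNum (L m : ℕ) : ℕ := PowerSeries.coeff m (dSeries L)

/-- The exponent `e^ℓ_m`. -/
def eNum (L m : ℕ) : ℕ := PowerSeries.coeff m (eSeries L)

end ConformalGalilei

end

open ConformalGalilei

noncomputable section

namespace ConformalGalilei

/-! For `μ ≠ 0` the central element is invertible, and suitable quadratic expressions in the `P_n`
act on the `P_n` by commutators exactly as `C`, `D`, `H` do (`IsHeisenberg.oscC_lie`,
`IsHeisenberg.oscH_lie`, `IsHeisenberg.oscD_lie`). Subtracting them from `C`, `D`, `H` leaves a copy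
of `sl₂` that commutes with every `P_n`. The Verma module is thereby modelled on polynomials in `t,
x_0, …, x_L`: the `P_n` act as multiplications by and derivatives in the `x_j`, and the commuting
`sl₂` acts on powers of `t` as on its own Verma module. Its highest weight is `δ + (L + 1)² / 2`,
since the quadratic `D` has eigenvalue `-(L + 1)² / 2` on the vacuum (`oscD_one`).

On this Fock space there is a contravariant form for which monomials are orthogonal with explicit
norms `fockNorm`; its pullback is a Shapovalov form (`isShapovalov_pullbackForm`). Since `C` is
multiplication by `t` plus an operator preserving the degree in `t`, the vectors of the statement
map to the monomials by a unitriangular matrix (`det_transitionMatrix`). Hence the Kac determinant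
is the product of the norms of the monomials of level `m` (`kacDet_pullbackForm`).

The value `μ = 0`, where the quadratic expressions make no sense, is reached by continuity. Any
matrix element of a Shapovalov form is forced by contravariance and is a continuous function of `μ`
independent of the form (`exists_continuous_form`). The identities expressing sesquilinearity,
contravariance and vanishing on the defining left ideal hold for `μ ≠ 0` and so pass to `μ = 0`,
giving existence (`exists_isShapovalov`); the determinant formula passes to the limit in the same
way.

What remains is counting. A factor of the `sl₂` norm with index `i` occurs once for each monomial
divisible by `t^(i+1)`, and each `x_j` contributes one factor `μ`; the generating functions give `d`
and `e`. -/

theorem structI_symm {L k : ℕ} (hk : k ≤ 2 * L + 1) :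
    structI L (2 * L + 1 - k) = -structI L k := by
  have e1 : 2 * L + 1 - (2 * L + 1 - k) = k := by omega
  have e4 : (-1 : ℂ) ^ (k + L + 1) * (-1) ^ (2 * L + 1 - k + L + 1) = -1 := by
    rw [← pow_add]
    exact Odd.neg_one_pow ⟨2 * L + 1, by omega⟩
  unfold structI
  rw [e1]
  rcases neg_one_pow_eq_or ℂ (k + L + 1) with h5 | h5 <;> rw [h5] at e4 ⊢
  · linear_combination ((k.factorial : ℂ) * ((2 * L + 1 - k).factorial : ℂ)) * e4
  · linear_combination (-(k.factorial : ℂ) * ((2 * L + 1 - k).factorial : ℂ)) * e4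

/-! ### The quadratic `sl₂` inside the Heisenberg algebra. -/

section Oscillator

variable {A : Type*} [Ring A] [Algebra ℂ A]

/-- Heisenberg commutation relations with central charge `μ` for `p 0, …, p (2L + 1)`. -/
def IsHeisenberg (L : ℕ) (μ : ℂ) (p : ℕ → A) : Prop :=
  ∀ m n, ⁅p m, p n⁆ = if m + n = 2 * L + 1 then algebraMap ℂ A (structI L m * μ) else 0

/-- The coefficients of the quadratic expressions realizing `C` and `H`. -/
def oscCoeff (L : ℕ) (μ : ℂ) (n : ℕ) : ℂ :=
  (-1) ^ (n + L) / (2 * μ * (n.factorial * (2 * L - n).factorial))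

/-- The quadratic expression acting on the `p n` as `C` does. -/
def oscC (L : ℕ) (μ : ℂ) (p : ℕ → A) : A :=
  ∑ n ∈ Finset.range (2 * L + 1), oscCoeff L μ n • (p (n + 1) * p (2 * L + 1 - n))

/-- The quadratic expression acting on the `p n` as `H` does. -/
def oscH (L : ℕ) (μ : ℂ) (p : ℕ → A) : A :=
  ∑ n ∈ Finset.range (2 * L + 1), oscCoeff L μ n • (p n * p (2 * L - n))

/-- The expression acting on the `p n` as `D` does. -/
def oscD (L : ℕ) (μ : ℂ) (p : ℕ → A) : A := ⁅oscC L μ p, oscH L μ p⁆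

theorem mul_commutator {A : Type*} [Ring A] (a b c : A) :
    ⁅a * b, c⁆ = a * ⁅b, c⁆ + ⁅a, c⁆ * b := by
  simp only [Ring.lie_def]; noncomm_ring

theorem commutator_mul {A : Type*} [Ring A] (a b c : A) :
    ⁅a, b * c⁆ = ⁅a, b⁆ * c + b * ⁅a, c⁆ := by
  simp only [Ring.lie_def]; noncomm_ring

theorem sum_commutator {A ι : Type*} [Ring A] (s : Finset ι) (f : ι → A) (a : A) :
    ⁅∑ i ∈ s, f i, a⁆ = ∑ i ∈ s, ⁅f i, a⁆ := by
  simp only [Ring.lie_def, Finset.sum_mul, Finset.mul_sum, Finset.sum_sub_distrib]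

theorem commutator_sum {A ι : Type*} [Ring A] (s : Finset ι) (f : ι → A) (a : A) :
    ⁅a, ∑ i ∈ s, f i⁆ = ∑ i ∈ s, ⁅a, f i⁆ := by
  simp only [Ring.lie_def, Finset.sum_mul, Finset.mul_sum, Finset.sum_sub_distrib]

theorem smul_commutator (c : ℂ) (a b : A) : ⁅c • a, b⁆ = c • ⁅a, b⁆ := by
  simp [Ring.lie_def, smul_sub]

theorem commutator_smul (c : ℂ) (a b : A) : ⁅a, c • b⁆ = c • ⁅a, b⁆ := by
  simp [Ring.lie_def, smul_sub]

theorem commutator_commutator {A : Type*} [Ring A] (a b c : A) :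
    ⁅⁅a, b⁆, c⁆ = ⁅a, ⁅b, c⁆⁆ - ⁅b, ⁅a, c⁆⁆ := by
  simp only [Ring.lie_def]; noncomm_ring

theorem oscCoeff_symm {L n : ℕ} (μ : ℂ) (hn : n ≤ 2 * L) :
    oscCoeff L μ (2 * L - n) = oscCoeff L μ n := by
  have e : 2 * L - (2 * L - n) = n := by omega
  have h : (-1 : ℂ) ^ (2 * L - n + L) = (-1) ^ (n + L) := by
    rw [neg_one_pow_congr]
    rw [Nat.even_add, Nat.even_add, Nat.even_sub hn]
    simp
  unfold oscCoeff
  rw [e, h, mul_comm ((Nat.factorial (2 * L - n) : ℂ))]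

/-- This is the normalization behind the definition of `oscCoeff`: by the symmetry of the
coefficients a commutator with the quadratic sum picks up the same multiple of one `p` twice, and
the total must be the structure constant of the action of `C`. -/
theorem oscCoeff_mul_structI {L k : ℕ} {μ : ℂ} (hμ : μ ≠ 0) (hk : k ≤ 2 * L) :
    2 * oscCoeff L μ k * (structI L (2 * L + 1 - k) * μ) = 2 * L + 1 - k := by
  have e1 : 2 * L + 1 - (2 * L + 1 - k) = k := by omega
  have e2 : 2 * L + 1 - k = (2 * L - k) + 1 := by omega
  have e3 : (-1 : ℂ) ^ (k + L) * (-1) ^ (2 * L + 1 - k + L + 1) = 1 := by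
    rw [← pow_add]
    exact Even.neg_one_pow ⟨2 * L + 1, by omega⟩
  unfold oscCoeff structI
  rw [e1]
  have h1 : ((2 * L + 1 - k).factorial : ℂ) = (2 * L + 1 - k) * (2 * L - k).factorial := by
    rw [e2, Nat.factorial_succ]
    push_cast [hk]
    ring
  rw [h1]
  have h2 : (k.factorial : ℂ) ≠ 0 := by exact_mod_cast k.factorial_ne_zero
  have h3 : ((2 * L - k).factorial : ℂ) ≠ 0 := by exact_mod_cast (2 * L - k).factorial_ne_zero
  field_simp
  linear_combination (2 * (L : ℂ) + 1 - k) * e3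

variable {L : ℕ} {μ : ℂ} {p : ℕ → A}

theorem IsHeisenberg.comm (hp : IsHeisenberg L μ p) {m n : ℕ} (h : m + n ≠ 2 * L + 1) :
    p m * p n = p n * p m := by
  have := hp m n
  rw [if_neg h, Ring.lie_def] at this
  exact sub_eq_zero.mp this

theorem IsHeisenberg.oscC_lie (hp : IsHeisenberg L μ p) (hμ : μ ≠ 0) {k : ℕ}
    (hk : k ≤ 2 * L + 1) : ⁅oscC L μ p, p k⁆ = (2 * L + 1 - k : ℂ) • p (k + 1) := by
  unfold oscC
  rw [sum_commutator]
  -- By the Leibniz rule only two terms survive: `n = k` from the second factor and `n = 2L - k`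
  -- from the first. The condition `k ≤ 2 * L` excludes `k = 2L + 1`, where truncated subtraction
  -- would produce a spurious index `0`.
  have hterm : ∀ n ∈ Finset.range (2 * L + 1),
      ⁅oscCoeff L μ n • (p (n + 1) * p (2 * L + 1 - n)), p k⁆ =
        (if n = k then (oscCoeff L μ k * (structI L (2 * L + 1 - k) * μ)) • p (k + 1) else 0) +
        (if n = 2 * L - k ∧ k ≤ 2 * L then
          (oscCoeff L μ k * (structI L (2 * L + 1 - k) * μ)) • p (k + 1) else 0) := by
    intro n hn
    rw [Finset.mem_range] at hn
    rw [smul_commutator, mul_commutator, hp, hp, smul_add]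
    congr 1
    · by_cases h : n = k
      · subst h
        rw [if_pos (by omega), if_pos rfl, ← Algebra.commutes, ← Algebra.smul_def, smul_smul]
      · rw [if_neg (by omega), if_neg h]; simp
    · by_cases h : n = 2 * L - k ∧ k ≤ 2 * L
      · obtain ⟨rfl, h2⟩ := h
        rw [if_pos (by omega), if_pos ⟨rfl, h2⟩, ← Algebra.smul_def, smul_smul,
          oscCoeff_symm μ h2]
        congr 3
        · congr 2; omega
        · omega
      · rw [if_neg (by omega), if_neg h]; simp
  rw [Finset.sum_congr rfl hterm, Finset.sum_add_distrib]
  by_cases h2 : k ≤ 2 * L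
  · simp only [h2, and_true]
    rw [Finset.sum_ite_eq', Finset.sum_ite_eq', if_pos (Finset.mem_range.mpr (by omega)), if_pos (Finset.mem_range.mpr (by omega)),
      ← oscCoeff_mul_structI hμ h2]
    module
  · have h3 : k = 2 * L + 1 := by omega
    simp only [h2, and_false]
    rw [Finset.sum_ite_eq', if_neg (by simp; omega), h3]
    simp

theorem IsHeisenberg.oscH_lie (hp : IsHeisenberg L μ p) (hμ : μ ≠ 0) {k : ℕ}
    (hk : k ≤ 2 * L + 1) : ⁅oscH L μ p, p k⁆ = (-k : ℂ) • p (k - 1) := by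
  unfold oscH
  rw [sum_commutator]
  -- Here the surviving indices are `k - 1` and `2L + 1 - k`; the condition `1 ≤ k` guards against
  -- truncation of `k - 1` at `k = 0`.
  have hterm : ∀ n ∈ Finset.range (2 * L + 1),
      ⁅oscCoeff L μ n • (p n * p (2 * L - n)), p k⁆ =
        (if n = k - 1 ∧ 1 ≤ k then
          (oscCoeff L μ (k - 1) * (structI L (2 * L + 1 - k) * μ)) • p (k - 1) else 0) +
        (if n = 2 * L + 1 - k ∧ 1 ≤ k then
          (oscCoeff L μ (k - 1) * (structI L (2 * L + 1 - k) * μ)) • p (k - 1) else 0) := by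
    intro n hn
    rw [Finset.mem_range] at hn
    rw [smul_commutator, mul_commutator, hp, hp, smul_add]
    congr 1
    · by_cases h : n = k - 1 ∧ 1 ≤ k
      · obtain ⟨rfl, h2⟩ := h
        rw [if_pos (by omega), if_pos ⟨rfl, h2⟩, ← Algebra.commutes, ← Algebra.smul_def, smul_smul]
        congr 4
        omega
      · rw [if_neg (by omega), if_neg h]; simp
    · by_cases h : n = 2 * L + 1 - k ∧ 1 ≤ k
      · obtain ⟨rfl, h2⟩ := h
        rw [if_pos (by omega), if_pos ⟨rfl, h2⟩, ← Algebra.smul_def, smul_smul,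
          ← oscCoeff_symm μ (n := k - 1) (by omega),
          show 2 * L - (k - 1) = 2 * L + 1 - k by omega,
          show 2 * L - (2 * L + 1 - k) = k - 1 by omega]
      · rw [if_neg (by omega), if_neg h]; simp
  rw [Finset.sum_congr rfl hterm, Finset.sum_add_distrib]
  by_cases h2 : 1 ≤ k
  · simp only [h2, and_true]
    rw [Finset.sum_ite_eq', Finset.sum_ite_eq', if_pos (Finset.mem_range.mpr (by omega)), if_pos (Finset.mem_range.mpr (by omega))]
    have e : (-k : ℂ) = 2 * oscCoeff L μ (k - 1) * (structI L (2 * L + 1 - k) * μ) := by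
      have h4 := oscCoeff_mul_structI hμ (L := L) (k := 2 * L + 1 - k) (by omega)
      have e1 : 2 * L + 1 - (2 * L + 1 - k) = k := by omega
      have e2 : 2 * L - (k - 1) = 2 * L + 1 - k := by omega
      have e3 : structI L k = - structI L (2 * L + 1 - k) := by rw [structI_symm hk, neg_neg]
      rw [e1, e3, ← e2, oscCoeff_symm μ (by omega), e2, Nat.cast_sub hk] at h4
      push_cast at h4
      linear_combination h4
    rw [e]
    module
  · have h3 : k = 0 := by omega
    simp [h3]

theorem IsHeisenberg.oscD_lie (hp : IsHeisenberg L μ p) (hμ : μ ≠ 0) {k : ℕ}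
    (hk : k ≤ 2 * L + 1) : ⁅oscD L μ p, p k⁆ = (2 * L + 1 - 2 * k : ℂ) • p k := by
  unfold oscD
  rw [commutator_commutator, hp.oscH_lie hμ hk, hp.oscC_lie hμ hk, commutator_smul, commutator_smul,
    hp.oscC_lie hμ (by omega)]
  -- By the Jacobi identity the commutator is a difference of two terms. At `k = 0` and at `k = 2L +
  -- 1` one of them has coefficient zero, so the meaningless indices `0 - 1` and `2L + 2` do no
  -- harm.
  rcases Nat.lt_or_ge k (2 * L + 1) with h | h
  · rw [hp.oscH_lie hμ (by omega)]
    rcases Nat.eq_zero_or_pos k with rfl | h0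
    · simp
    · obtain ⟨k, rfl⟩ : ∃ i, k = i + 1 := ⟨k - 1, by omega⟩
      simp only [Nat.add_sub_cancel]
      push_cast
      module
  · have h3 : k = 2 * L + 1 := by omega
    subst h3
    simp only [Nat.add_sub_cancel]
    push_cast
    module

/-- Every product in the sum has indices adding up to `2L + 2`, so the `D`-weights of its factors
add up to `-2`. For `oscH` the indices add up to `2L` and the weight is `2`. -/
theorem IsHeisenberg.oscD_lie_oscC (hp : IsHeisenberg L μ p) (hμ : μ ≠ 0) :
    ⁅oscD L μ p, oscC L μ p⁆ = (-2 : ℂ) • oscC L μ p := by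
  conv_lhs => rw [oscC]
  rw [commutator_sum, oscC, Finset.smul_sum]
  refine Finset.sum_congr rfl fun n hn => ?_
  rw [Finset.mem_range] at hn
  rw [commutator_smul, commutator_mul, hp.oscD_lie hμ (by omega), hp.oscD_lie hμ (by omega),
    smul_mul_assoc, mul_smul_comm, Nat.cast_sub (by omega)]
  push_cast
  module

theorem IsHeisenberg.oscD_lie_oscH (hp : IsHeisenberg L μ p) (hμ : μ ≠ 0) :
    ⁅oscD L μ p, oscH L μ p⁆ = (2 : ℂ) • oscH L μ p := by
  conv_lhs => rw [oscH]
  rw [commutator_sum, oscH, Finset.smul_sum]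
  refine Finset.sum_congr rfl fun n hn => ?_
  rw [Finset.mem_range] at hn
  rw [commutator_smul, commutator_mul, hp.oscD_lie hμ (by omega), hp.oscD_lie hμ (by omega),
    smul_mul_assoc, mul_smul_comm, Nat.cast_sub (by omega)]
  push_cast
  module

end Oscillator

end ConformalGalilei

/-! ### The Fock representation for `μ ≠ 0`. -/

namespace ConformalGalilei

open MvPolynomial

/-- The space of polynomials in `t` (the variable `none`) and `x_0, …, x_L`. -/
abbrev Fock (L : ℕ) : Type := MvPolynomial (Option (Fin (L + 1))) ℂ

/-- Multiplication by a variable. -/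
def mulX {L : ℕ} (i : Option (Fin (L + 1))) : Module.End ℂ (Fock L) := LinearMap.mulLeft ℂ (X i)

/-- Partial differentiation. -/
def dX {L : ℕ} (i : Option (Fin (L + 1))) : Module.End ℂ (Fock L) :=
  (pderiv i : Derivation ℂ (Fock L) (Fock L)).toLinearMap

theorem mulX_apply {L : ℕ} (i : Option (Fin (L + 1))) (f : Fock L) : mulX i f = X i * f := rfl

theorem dX_apply {L : ℕ} (i : Option (Fin (L + 1))) (f : Fock L) : dX i f = pderiv i f := rfl

theorem mulX_mul_mulX {L : ℕ} (i j : Option (Fin (L + 1))) : mulX i * mulX j = mulX j * mulX i := by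
  refine LinearMap.ext fun f => ?_
  simp only [Module.End.mul_apply, mulX_apply]
  ring

theorem dX_mul_dX {L : ℕ} (i j : Option (Fin (L + 1))) : dX i * dX j = dX j * dX i := by
  classical
  refine MvPolynomial.linearMap_ext fun s => LinearMap.ext_ring ?_
  simp only [LinearMap.comp_apply, Module.End.mul_apply, dX_apply, pderiv_monomial]
  by_cases h : i = j
  · rw [h]
  · have h' : j ≠ i := fun e => h e.symm
    simp only [Finsupp.coe_tsub, Pi.sub_apply, Finsupp.single_apply, h, h', if_false, tsub_zero]
    congr 1
    · rw [tsub_right_comm]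
    · ring

theorem dX_mul_mulX {L : ℕ} (i j : Option (Fin (L + 1))) :
    dX i * mulX j = mulX j * dX i + if i = j then 1 else 0 := by
  classical
  refine LinearMap.ext fun f => ?_
  simp only [Module.End.mul_apply, mulX_apply, dX_apply, LinearMap.add_apply, pderiv_mul, pderiv_X,
    Pi.single_apply]
  split_ifs <;> simp [eq_comm] at * <;> ring_nf <;> simp_all

/-- The representation of `P_n` on the polynomials. -/
def fockP (L : ℕ) (μ : ℂ) (n : ℕ) : Module.End ℂ (Fock L) :=
  if n ≤ L then (structI L n * μ) • dX (some (Fin.ofNat (L + 1) (L - n)))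
  else if n < 2 * L + 2 then mulX (some (Fin.ofNat (L + 1) (n - (L + 1)))) else 0

theorem fockP_low {L n : ℕ} (μ : ℂ) (h : n ≤ L) :
    fockP L μ n = (structI L n * μ) • dX (some (Fin.ofNat (L + 1) (L - n))) := if_pos h

theorem fockP_high {L n : ℕ} (μ : ℂ) (h : L < n) (h' : n < 2 * L + 2) :
    fockP L μ n = mulX (some (Fin.ofNat (L + 1) (n - (L + 1)))) := by
  rw [fockP, if_neg (by omega), if_pos h']

theorem fockP_zero {L n : ℕ} (μ : ℂ) (h' : 2 * L + 2 ≤ n) : fockP L μ n = 0 := by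
  rw [fockP, if_neg (by omega), if_neg (by omega)]

theorem ofNat_eq_iff {L a b : ℕ} (ha : a < L + 1) (hb : b < L + 1) :
    Fin.ofNat (L + 1) a = Fin.ofNat (L + 1) b ↔ a = b := by
  rw [Fin.ext_iff]
  simp [Fin.ofNat, Nat.mod_eq_of_lt ha, Nat.mod_eq_of_lt hb]

theorem fockP_low_mul_high {L m n : ℕ} (μ : ℂ) (hm : m ≤ L) (hn : L < n) :
    fockP L μ m * fockP L μ n = fockP L μ n * fockP L μ m +
      if m + n = 2 * L + 1 then algebraMap ℂ (Module.End ℂ (Fock L)) (structI L m * μ) else 0 := by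
  rcases lt_or_ge n (2 * L + 2) with hn' | hn'
  · rw [fockP_low μ hm, fockP_high μ hn hn', smul_mul_assoc, mul_smul_comm, dX_mul_mulX,
      smul_add, Algebra.algebraMap_eq_smul_one, smul_ite, smul_zero]
    congr 1
    refine if_congr ?_ rfl rfl
    rw [Option.some_inj, ofNat_eq_iff (by omega) (by omega)]
    omega
  · rw [if_neg (by omega), fockP_zero μ hn']; simp

theorem isHeisenberg_fockP (L : ℕ) (μ : ℂ) : IsHeisenberg L μ (fockP L μ) := by
  intro m n
  rw [Ring.lie_def, sub_eq_iff_eq_add']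
  rcases le_or_gt m L with hm | hm <;> rcases le_or_gt n L with hn | hn
  · rw [if_neg (by omega), add_zero, fockP_low μ hm, fockP_low μ hn]
    simp only [smul_mul_assoc, mul_smul_comm, dX_mul_dX (some (Fin.ofNat (L + 1) (L - m)))]
    rw [smul_comm]
  · exact fockP_low_mul_high μ hm hn
  · rw [fockP_low_mul_high μ hn hm, add_assoc, left_eq_add]
    by_cases h : m + n = 2 * L + 1
    · rw [if_pos (by omega), if_pos h, ← map_add, show m = 2 * L + 1 - n by omega,
        structI_symm (by omega)]
      simp
    · rw [if_neg (by omega), if_neg h, add_zero]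
  · rw [if_neg (by omega), add_zero]
    rcases lt_or_ge m (2 * L + 2) with hm' | hm'
    · rcases lt_or_ge n (2 * L + 2) with hn' | hn'
      · rw [fockP_high μ hn hn', fockP_high μ hm hm', mulX_mul_mulX]
      · rw [fockP_zero μ hn']; simp
    · rw [fockP_zero μ hm']; simp

/-- The action of `C` on the Verma module of `sl₂` realized on polynomials in `t`. -/
def slC (L : ℕ) : Module.End ℂ (Fock L) := mulX none

/-- The action of `H` on the Verma module of `sl₂` of highest weight `ν`. -/
def slH (L : ℕ) (ν : ℂ) : Module.End ℂ (Fock L) := mulX none * dX none * dX none - ν • dX none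

/-- The action of `D` on the Verma module of `sl₂` of highest weight `ν`. -/
def slD (L : ℕ) (ν : ℂ) : Module.End ℂ (Fock L) := ν • 1 - (2 : ℂ) • (mulX none * dX none)

theorem slC_lie_slH (L : ℕ) (ν : ℂ) : ⁅slC L, slH L ν⁆ = slD L ν := by
  refine LinearMap.ext fun f => ?_
  simp only [Ring.lie_def, slC, slH, slD, LinearMap.sub_apply, Module.End.mul_apply, mulX_apply,
    dX_apply, LinearMap.smul_apply, pderiv_mul, pderiv_X_self, map_add, Module.End.one_apply,
    smul_eq_C_mul]
  have h2 : (C 2 : Fock L) = 2 := map_ofNat C 2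
  simp [h2]
  ring

theorem slD_lie_slC (L : ℕ) (ν : ℂ) : ⁅slD L ν, slC L⁆ = (-2 : ℂ) • slC L := by
  refine LinearMap.ext fun f => ?_
  simp only [Ring.lie_def, slC, slD, LinearMap.sub_apply, Module.End.mul_apply, mulX_apply,
    dX_apply, LinearMap.smul_apply, pderiv_mul, pderiv_X_self, map_add, Module.End.one_apply,
    smul_eq_C_mul]
  simp
  ring

theorem slD_lie_slH (L : ℕ) (ν : ℂ) : ⁅slD L ν, slH L ν⁆ = (2 : ℂ) • slH L ν := by
  refine LinearMap.ext fun f => ?_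
  simp only [Ring.lie_def, slH, slD, LinearMap.sub_apply, Module.End.mul_apply, mulX_apply,
    dX_apply, LinearMap.smul_apply, pderiv_mul, pderiv_X_self, map_add, map_sub,
    Module.End.one_apply, smul_eq_C_mul, pderiv_C]
  simp
  ring

/-- The `P_n` involve only the variables `x_j`, never `t`; together with the analogous fact for `dX
none` this makes the `t`-copy of `sl₂` commute with the `P_n` and with their quadratic expressions.
-/
theorem commute_fockP_mulX (L n : ℕ) (μ : ℂ) : Commute (mulX none) (fockP L μ n) := by
  unfold fockP
  split_ifs
  · refine Commute.smul_right ?_ _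
    rw [Commute, SemiconjBy, dX_mul_mulX]
    simp
  · exact mulX_mul_mulX _ _
  · exact Commute.zero_right _

theorem commute_fockP_dX (L n : ℕ) (μ : ℂ) : Commute (dX none) (fockP L μ n) := by
  unfold fockP
  split_ifs
  · exact Commute.smul_right (dX_mul_dX _ _) _
  · rw [Commute, SemiconjBy, dX_mul_mulX]
    simp
  · exact Commute.zero_right _

theorem Commute.oscC_right {A : Type*} [Ring A] [Algebra ℂ A] {a : A} {p : ℕ → A} (L : ℕ) (μ : ℂ)
    (h : ∀ n, Commute a (p n)) : Commute a (oscC L μ p) :=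
  Commute.sum_right _ _ _ fun _ _ => ((h _).mul_right (h _)).smul_right _

theorem Commute.oscH_right {A : Type*} [Ring A] [Algebra ℂ A] {a : A} {p : ℕ → A} (L : ℕ) (μ : ℂ)
    (h : ∀ n, Commute a (p n)) : Commute a (oscH L μ p) :=
  Commute.sum_right _ _ _ fun _ _ => ((h _).mul_right (h _)).smul_right _

theorem Commute.oscD_right {A : Type*} [Ring A] [Algebra ℂ A] {a : A} {p : ℕ → A} (L : ℕ) (μ : ℂ)
    (h : ∀ n, Commute a (p n)) : Commute a (oscD L μ p) :=
  ((Commute.oscC_right L μ h).mul_right (Commute.oscH_right L μ h)).sub_right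
    ((Commute.oscH_right L μ h).mul_right (Commute.oscC_right L μ h))

theorem commute_slC (L n : ℕ) (μ : ℂ) : Commute (slC L) (fockP L μ n) :=
  commute_fockP_mulX L n μ

theorem commute_slH (L n : ℕ) (ν μ : ℂ) : Commute (slH L ν) (fockP L μ n) :=
  (((commute_fockP_mulX L n μ).mul_left (commute_fockP_dX L n μ)).mul_left
    (commute_fockP_dX L n μ)).sub_left ((commute_fockP_dX L n μ).smul_left _)

theorem commute_slD (L n : ℕ) (ν μ : ℂ) : Commute (slD L ν) (fockP L μ n) :=
  ((Commute.one_left _).smul_left _).sub_left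
    (((commute_fockP_mulX L n μ).mul_left (commute_fockP_dX L n μ)).smul_left _)

/-- The highest weight of the `sl₂`-factor. -/
def slWeight (L : ℕ) (δ : ℂ) : ℂ := δ + (L + 1) ^ 2 / 2

/-- The action of the generators on the Fock space. -/
def fockGen (L : ℕ) (δ μ : ℂ) : Gen L → Module.End ℂ (Fock L)
  | .C => slC L + oscC L μ (fockP L μ)
  | .D => slD L (slWeight L δ) + oscD L μ (fockP L μ)
  | .H => slH L (slWeight L δ) + oscH L μ (fockP L μ)
  | .M => μ • 1
  | .P n => fockP L μ n

/-- The action of the algebra on the Fock space. -/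
def fockRep (L : ℕ) (δ μ : ℂ) : CGA L →ₗ[ℂ] Module.End ℂ (Fock L) :=
  Finsupp.linearCombination ℂ (fockGen L δ μ)

theorem fockRep_gen {L : ℕ} (δ μ : ℂ) (a : Gen L) : fockRep L δ μ (gen a) = fockGen L δ μ a := by
  unfold fockRep gen
  erw [Finsupp.linearCombination_single, one_smul]

theorem fockRep_pVec (L n : ℕ) (δ μ : ℂ) : fockRep L δ μ (pVec L n) = fockP L μ n := by
  unfold pVec
  split_ifs with h
  · rw [fockRep_gen, fockGen]
  · rw [map_zero, fockP_zero μ (by omega)]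

theorem commutator_add_add {A : Type*} [Ring A] {a b c d : A} (h1 : Commute a d)
    (h2 : Commute c b) : ⁅a + b, c + d⁆ = ⁅a, c⁆ + ⁅b, d⁆ := by
  simp only [Ring.lie_def, add_mul, mul_add, h1.eq, h2.eq]
  abel

theorem commutator_skew {A : Type*} [Ring A] (a b : A) : -⁅a, b⁆ = ⁅b, a⁆ := by
  simp [Ring.lie_def]

theorem commutator_commute_add {A : Type*} [Ring A] {a b c : A} (h1 : Commute a c) :
    ⁅a + b, c⁆ = ⁅b, c⁆ := by
  simp only [Ring.lie_def, add_mul, mul_add, h1.eq]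
  abel

/-- Brackets inside `sl₂` split into a `t`-part and a quadratic part because the cross terms
commute. In brackets with `P_n` the `t`-part drops out and the quadratic part gives the required
action. Antisymmetry supplies the reversed pairs. -/
theorem fockRep_bracketGen {L : ℕ} (δ : ℂ) {μ : ℂ} (hμ : μ ≠ 0) (a b : Gen L) :
    fockRep L δ μ (bracketGen L a b) = ⁅fockGen L δ μ a, fockGen L δ μ b⁆ := by
  have hp := isHeisenberg_fockP L μ
  have skew {a b : Gen L} (h : fockRep L δ μ (bracketGen L a b) =
      ⁅fockGen L δ μ a, fockGen L δ μ b⁆) :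
      fockRep L δ μ (bracketGen L b a) = ⁅fockGen L δ μ b, fockGen L δ μ a⁆ := by
    rw [bracketGen_antisymm, map_neg, h, commutator_skew]
  have hM (x : Module.End ℂ (Fock L)) : ⁅(μ • 1 : Module.End ℂ (Fock L)), x⁆ = 0 := by
    simp [Ring.lie_def]
  have hself (x : Module.End ℂ (Fock L)) : ⁅x, x⁆ = 0 := by simp [Ring.lie_def]
  have hDH : fockRep L δ μ (bracketGen L .D .H) = ⁅fockGen L δ μ .D, fockGen L δ μ .H⁆ := by
    simp only [bracketGen, map_smul, fockRep_gen, fockGen]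
    rw [commutator_add_add (Commute.oscH_right L μ fun n => commute_slD L n _ μ)
      (Commute.oscD_right L μ fun n => commute_slH L n _ μ), slD_lie_slH, hp.oscD_lie_oscH hμ,
      smul_add]
  have hDC : fockRep L δ μ (bracketGen L .D .C) = ⁅fockGen L δ μ .D, fockGen L δ μ .C⁆ := by
    simp only [bracketGen, map_smul, fockRep_gen, fockGen]
    rw [commutator_add_add (Commute.oscC_right L μ fun n => commute_slD L n _ μ)
      (Commute.oscD_right L μ fun n => commute_slC L n μ), slD_lie_slC, hp.oscD_lie_oscC hμ,
      smul_add]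
  have hCH : fockRep L δ μ (bracketGen L .C .H) = ⁅fockGen L δ μ .C, fockGen L δ μ .H⁆ := by
    simp only [bracketGen, fockRep_gen, fockGen]
    rw [commutator_add_add (Commute.oscH_right L μ fun n => commute_slC L n μ)
      (Commute.oscC_right L μ fun n => commute_slH L n _ μ), slC_lie_slH, oscD]
  have hHP (n) : fockRep L δ μ (bracketGen L .H (.P n)) =
      ⁅fockGen L δ μ .H, fockGen L δ μ (.P n)⁆ := by
    simp only [bracketGen, map_smul, fockRep_pVec, fockGen]
    rw [commutator_commute_add (commute_slH L n _ μ), hp.oscH_lie hμ (by omega)]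
  have hDP (n) : fockRep L δ μ (bracketGen L .D (.P n)) =
      ⁅fockGen L δ μ .D, fockGen L δ μ (.P n)⁆ := by
    simp only [bracketGen, map_smul, fockRep_gen, fockGen]
    rw [commutator_commute_add (commute_slD L n _ μ), hp.oscD_lie hμ (by omega), mul_sub, spin_two]
  have hCP (n) : fockRep L δ μ (bracketGen L .C (.P n)) =
      ⁅fockGen L δ μ .C, fockGen L δ μ (.P n)⁆ := by
    simp only [bracketGen, map_smul, fockRep_pVec, fockGen]
    rw [commutator_commute_add (commute_slC L n μ), hp.oscC_lie hμ (by omega), spin_two]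
  have hPP (m n) : fockRep L δ μ (bracketGen L (.P m) (.P n)) =
      ⁅fockGen L δ μ (.P m), fockGen L δ μ (.P n)⁆ := by
    simp only [bracketGen, fockGen, hp _ _]
    split_ifs
    · rw [map_smul, fockRep_gen, fockGen, smul_smul, Algebra.algebraMap_eq_smul_one]
    · exact map_zero _
  have hMx (b) : fockRep L δ μ (bracketGen L .M b) = ⁅fockGen L δ μ .M, fockGen L δ μ b⁆ := by
    simp only [fockGen, hM]
    cases b <;> simp [bracketGen]
  match a, b with
  | .M, b => exact hMx b
  | .C, .M => exact skew (hMx .C)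
  | .D, .M => exact skew (hMx .D)
  | .H, .M => exact skew (hMx .H)
  | .P n, .M => exact skew (hMx (.P n))
  | .D, .H => exact hDH
  | .H, .D => exact skew hDH
  | .D, .C => exact hDC
  | .C, .D => exact skew hDC
  | .C, .H => exact hCH
  | .H, .C => exact skew hCH
  | .H, .P n => exact hHP n
  | .P n, .H => exact skew (hHP n)
  | .D, .P n => exact hDP n
  | .P n, .D => exact skew (hDP n)
  | .C, .P n => exact hCP n
  | .P n, .C => exact skew (hCP n)
  | .P m, .P n => exact hPP m n
  | .C, .C => rw [hself, bracketGen, map_zero]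
  | .D, .D => rw [hself, bracketGen, map_zero]
  | .H, .H => rw [hself, bracketGen, map_zero]

theorem fockRep_lie {L : ℕ} (δ : ℂ) {μ : ℂ} (hμ : μ ≠ 0) (x y : CGA L) :
    fockRep L δ μ (bracketMap L x y) =
      fockRep L δ μ x * fockRep L δ μ y - fockRep L δ μ y * fockRep L δ μ x := by
  induction x using induction_gen with
  | h0 => simp
  | hadd x x' hx hx' => rw [map_add, LinearMap.add_apply, map_add, hx, hx', map_add]; noncomm_ring
  | hgen c a =>
    induction y using induction_gen with
    | h0 => simp
    | hadd y y' hy hy' => rw [map_add, map_add, hy, hy', map_add]; noncomm_ring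
    | hgen d b =>
      simp only [map_smul, LinearMap.smul_apply, bracketMap_gen, fockRep_bracketGen δ hμ,
        fockRep_gen, Ring.lie_def, smul_mul_assoc, mul_smul_comm, smul_sub]
      rw [smul_comm c d]

section

attribute [local instance] LieRing.ofAssociativeRing

/-- The representation of the algebra on the Fock space, for `μ ≠ 0`. -/
def fockLie (L : ℕ) (δ : ℂ) {μ : ℂ} (hμ : μ ≠ 0) : CGA L →ₗ⁅ℂ⁆ Module.End ℂ (Fock L) :=
  { fockRep L δ μ with
    map_lie' := fun {x y} => fockRep_lie δ hμ x y }

/-- The representation of the enveloping algebra on the Fock space, for `μ ≠ 0`. -/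
def fockU (L : ℕ) (δ : ℂ) {μ : ℂ} (hμ : μ ≠ 0) : U L →ₐ[ℂ] Module.End ℂ (Fock L) :=
  UniversalEnvelopingAlgebra.lift ℂ (fockLie L δ hμ)

theorem fockU_toU {L : ℕ} (δ : ℂ) {μ : ℂ} (hμ : μ ≠ 0) (x : CGA L) :
    fockU L δ hμ (toU x) = fockRep L δ μ x :=
  UniversalEnvelopingAlgebra.lift_ι_apply ℂ (fockLie L δ hμ) x

end

end ConformalGalilei

namespace ConformalGalilei

open MvPolynomial

/-! ### The constant polynomial as highest weight vector, and the map from the Verma module. -/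

section Vacuum

theorem fockP_one {L n : ℕ} (μ : ℂ) (h : n ≤ L) : fockP L μ n 1 = 0 := by
  rw [fockP_low μ h, LinearMap.smul_apply, dX_apply, pderiv_one, smul_zero]

theorem fockP_fockP {L m n : ℕ} {μ : ℂ} (h : m + n ≠ 2 * L + 1) (f : Fock L) :
    fockP L μ m (fockP L μ n f) = fockP L μ n (fockP L μ m f) :=
  LinearMap.congr_fun ((isHeisenberg_fockP L μ).comm h) f

/-- Two indices adding up to `2L` commute, and one of them is at most `L`; moved to the right, it
kills the vacuum. -/
theorem oscH_one (L : ℕ) (μ : ℂ) : oscH L μ (fockP L μ) 1 = 0 := by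
  rw [oscH, LinearMap.sum_apply]
  refine Finset.sum_eq_zero fun n hn => ?_
  rw [Finset.mem_range] at hn
  rw [LinearMap.smul_apply, Module.End.mul_apply]
  rcases le_or_gt n L with h | h
  · rw [fockP_fockP (by omega), fockP_one μ h, map_zero, smul_zero]
  · rw [fockP_one μ (show 2 * L - n ≤ L by omega), map_zero, smul_zero]

/-- The two indices add up to `2L + 2` and commute; unless both equal `L + 1`, one of them is at
most `L` and annihilates the vacuum. -/
theorem oscC_one (L : ℕ) (μ : ℂ) : oscC L μ (fockP L μ) 1 =
    oscCoeff L μ L • fockP L μ (L + 1) (fockP L μ (L + 1) 1) := by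
  rw [oscC, LinearMap.sum_apply, Finset.sum_eq_single L]
  · rw [LinearMap.smul_apply, Module.End.mul_apply, show 2 * L + 1 - L = L + 1 by omega]
  · intro n hn hne
    rw [Finset.mem_range] at hn
    rw [LinearMap.smul_apply, Module.End.mul_apply]
    rcases lt_or_gt_of_ne hne with h | h
    · rw [fockP_fockP (by omega), fockP_one μ (show n + 1 ≤ L by omega), map_zero, smul_zero]
    · rw [fockP_one μ (show 2 * L + 1 - n ≤ L by omega), map_zero, smul_zero]
  · intro h
    exact absurd (Finset.mem_range.mpr (by omega)) h

/-- Since `oscH` kills the vacuum, only `-oscH (oscC 1)` is left. Commuting `oscH` through the two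
factors `P_{L+1}` gives a single contraction `[P_L, P_{L+1}]`. The resulting eigenvalue is what
`slWeight` compensates. -/
theorem oscD_one (L : ℕ) {μ : ℂ} (hμ : μ ≠ 0) :
    oscD L μ (fockP L μ) 1 = (-((L + 1) ^ 2 / 2) : ℂ) • 1 := by
  have hp := isHeisenberg_fockP L μ
  have h1 (f : Fock L) : oscH L μ (fockP L μ) (fockP L μ (L + 1) f) =
      fockP L μ (L + 1) (oscH L μ (fockP L μ) f) - ((L : ℂ) + 1) • fockP L μ L f := by
    have := LinearMap.congr_fun (hp.oscH_lie hμ (k := L + 1) (by omega)) f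
    rw [Ring.lie_def, LinearMap.sub_apply, Module.End.mul_apply, Module.End.mul_apply,
      LinearMap.smul_apply, Nat.add_sub_cancel, sub_eq_iff_eq_add] at this
    rw [this]
    push_cast
    module
  have h2 : fockP L μ L (fockP L μ (L + 1) 1) = (structI L L * μ) • (1 : Fock L) := by
    have := LinearMap.congr_fun (hp L (L + 1)) 1
    rw [Ring.lie_def, LinearMap.sub_apply, Module.End.mul_apply, Module.End.mul_apply,
      fockP_one μ le_rfl, map_zero, sub_zero, if_pos (by omega)] at this
    rw [this, Module.algebraMap_end_apply]
  have h3 := oscCoeff_mul_structI hμ (L := L) (k := L) (by omega)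
  rw [structI_symm (by omega)] at h3
  rw [oscD, Ring.lie_def, LinearMap.sub_apply, Module.End.mul_apply, Module.End.mul_apply,
    oscH_one, map_zero, oscC_one, map_smul, h1, h1, oscH_one, fockP_one μ le_rfl, h2]
  simp only [map_zero, smul_zero, sub_zero, zero_sub, smul_neg, smul_smul, neg_neg]
  congr 1
  linear_combination -((L : ℂ) + 1) / 2 * h3

theorem fockGen_H_one (L : ℕ) (δ μ : ℂ) : fockGen L δ μ .H 1 = 0 := by
  simp [fockGen, slH, dX_apply, oscH_one]

theorem fockGen_D_one (L : ℕ) (δ : ℂ) {μ : ℂ} (hμ : μ ≠ 0) : fockGen L δ μ .D 1 = δ • 1 := by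
  simp only [fockGen, LinearMap.add_apply, oscD_one L hμ, slD, LinearMap.sub_apply,
    LinearMap.smul_apply, Module.End.mul_apply, dX_apply, pderiv_one, map_zero, smul_zero,
    Module.End.one_apply, sub_zero, slWeight]
  module

theorem mk_eq_smul_hwv {L : ℕ} {δ μ : ℝ} (u : U L) :
    (Submodule.Quotient.mk u : Verma L δ μ) = u • hwv L δ μ := by
  rw [hwv, ← Submodule.Quotient.mk_smul, smul_eq_mul, mul_one]

theorem smul_hwv_eq_zero_iff {L : ℕ} {δ μ : ℝ} (u : U L) :
    u • hwv L δ μ = 0 ↔ u ∈ vermaIdeal L δ μ := by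
  rw [← mk_eq_smul_hwv, Submodule.Quotient.mk_eq_zero]

theorem exists_smul_hwv {L : ℕ} {δ μ : ℝ} (x : Verma L δ μ) : ∃ u : U L, x = u • hwv L δ μ := by
  obtain ⟨u, rfl⟩ := Submodule.Quotient.mk_surjective _ x
  exact ⟨u, mk_eq_smul_hwv u⟩

theorem fockU_one_eq_zero {L : ℕ} (δ : ℝ) {μ : ℝ} (hμ : (μ : ℂ) ≠ 0) {u : U L}
    (hu : u ∈ vermaIdeal L δ μ) : fockU L δ hμ u 1 = 0 := by
  unfold vermaIdeal at hu
  induction hu using Submodule.span_induction with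
  | zero => simp
  | add x y _ _ hx hy => rw [map_add, LinearMap.add_apply, hx, hy, add_zero]
  | smul a x _ hx => rw [smul_eq_mul, map_mul, Module.End.mul_apply, hx, map_zero]
  | mem x hx =>
    rcases hx with (hx | ⟨n, hn, hx⟩) | hx | hx
    · rw [hx, fockU_toU, fockRep_gen, fockGen_H_one]
    · rw [hx, fockU_toU, fockRep_pVec, fockP_one _ hn]
    · rw [hx, map_sub, fockU_toU, fockRep_gen, AlgHom.commutes, LinearMap.sub_apply,
        fockGen_D_one L _ hμ, Module.algebraMap_end_apply, sub_self]
    · rw [hx, map_sub, fockU_toU, fockRep_gen, AlgHom.commutes, LinearMap.sub_apply,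
        Module.algebraMap_end_apply, fockGen, LinearMap.smul_apply, Module.End.one_apply, sub_self]

/-- The homomorphism of the Verma module into the Fock space. -/
def vermaToFock (L : ℕ) (δ : ℝ) {μ : ℝ} (hμ : (μ : ℂ) ≠ 0) : Verma L δ μ →ₗ[ℂ] Fock L :=
  (((vermaIdeal L δ μ).restrictScalars ℂ).liftQ
    ((LinearMap.applyₗ (1 : Fock L)).comp (fockU L δ hμ).toLinearMap)
    fun _ hu => fockU_one_eq_zero δ hμ hu).comp
    (Submodule.Quotient.restrictScalarsEquiv ℂ (vermaIdeal L δ μ)).symm.toLinearMap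

theorem vermaToFock_smul_hwv {L : ℕ} (δ : ℝ) {μ : ℝ} (hμ : (μ : ℂ) ≠ 0) (u : U L) :
    vermaToFock L δ hμ (u • hwv L δ μ) = fockU L δ hμ u 1 := by
  rw [← mk_eq_smul_hwv]
  rfl

theorem vermaToFock_smul {L : ℕ} (δ : ℝ) {μ : ℝ} (hμ : (μ : ℂ) ≠ 0) (u : U L)
    (x : Verma L δ μ) :
    vermaToFock L δ hμ (u • x) = fockU L δ hμ u (vermaToFock L δ hμ x) := by
  obtain ⟨v, rfl⟩ := exists_smul_hwv x
  rw [smul_smul, vermaToFock_smul_hwv, vermaToFock_smul_hwv, map_mul, Module.End.mul_apply]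

end Vacuum

/-! ### The contravariant form on the Fock space and its pullback. -/

section Form

/-- The structure constants as real numbers. -/
def realI (L m : ℕ) : ℝ := (-1) ^ (m + L + 1) * m.factorial * (2 * L + 1 - m).factorial

theorem coe_realI (L m : ℕ) : (realI L m : ℂ) = structI L m := by
  simp [realI, structI]

theorem realI_ne_zero (L m : ℕ) : realI L m ≠ 0 := by
  simp [realI, Nat.factorial_ne_zero]

/-- The square norm of a monomial of the Fock space. -/
def fockNorm (L : ℕ) (ν μ : ℝ) (d : Option (Fin (L + 1)) →₀ ℕ) : ℝ :=
  (∏ i ∈ Finset.range (d none), (-((i : ℝ) + 1) * (ν - i))) *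
    ∏ j : Fin (L + 1), ((d (some j)).factorial * (realI L (L - j) * μ) ^ d (some j))

/-- The factor is the coefficient in `slH t^(k+1) = -(k+1)(ν - k) t^k`, as adjointness of `slC` and
`slH` demands. -/
theorem fockNorm_add_none (L : ℕ) (ν μ : ℝ) (d : Option (Fin (L + 1)) →₀ ℕ) :
    fockNorm L ν μ (d + Finsupp.single none 1) =
      -((d none : ℝ) + 1) * (ν - d none) * fockNorm L ν μ d := by
  simp [fockNorm, Finset.prod_range_succ]
  ring

theorem fockNorm_add_some (L : ℕ) (ν μ : ℝ) (d : Option (Fin (L + 1)) →₀ ℕ) (j : Fin (L + 1)) :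
    fockNorm L ν μ (d + Finsupp.single (some j) 1) =
      ((d (some j) : ℝ) + 1) * (realI L (L - j) * μ) * fockNorm L ν μ d := by
  unfold fockNorm
  rw [← Finset.mul_prod_erase _ _ (Finset.mem_univ j),
    ← Finset.mul_prod_erase (f := fun j : Fin (L + 1) => ((d (some j)).factorial : ℝ) *
      (realI L (L - j) * μ) ^ d (some j)) _ (Finset.mem_univ j)]
  have h : ∀ i ∈ Finset.univ.erase j,
      (d + Finsupp.single (some j) 1 : Option (Fin (L + 1)) →₀ ℕ) (some i) = d (some i) := by
    intro i hi
    have : j ≠ i := fun e => (Finset.mem_erase.mp hi).1 e.symm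
    simp [this]
  have h' : ∏ i ∈ Finset.univ.erase j,
      (((d + Finsupp.single (some j) 1 : Option (Fin (L + 1)) →₀ ℕ) (some i)).factorial *
        (realI L (L - i) * μ) ^
          ((d + Finsupp.single (some j) 1 : Option (Fin (L + 1)) →₀ ℕ) (some i))) =
      ∏ i ∈ Finset.univ.erase j, (((d (some i)).factorial : ℝ) *
        (realI L (L - i) * μ) ^ d (some i)) :=
    Finset.prod_congr rfl fun i hi => by rw [h i hi]
  rw [h']
  simp [Nat.factorial_succ, pow_succ]
  ring

variable {L : ℕ}

/-- The contravariant form on the Fock space. -/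
def fockForm (L : ℕ) (ν μ : ℝ) : Fock L →ₗ⋆[ℂ] Fock L →ₗ[ℂ] ℂ :=
  LinearMap.mk₂'ₛₗ (starRingEnd ℂ) (RingHom.id ℂ)
    (fun f g => ∑ d ∈ f.support, conj (coeff d f) * fockNorm L ν μ d * coeff d g)
    (fun f f' g => by
      classical
      have key (h : Fock L) (hs : h.support ⊆ f.support ∪ f'.support) :
          ∑ d ∈ h.support, conj (coeff d h) * fockNorm L ν μ d * coeff d g =
          ∑ d ∈ f.support ∪ f'.support, conj (coeff d h) * fockNorm L ν μ d * coeff d g :=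
        Finset.sum_subset hs fun d _ hd => by simp [notMem_support_iff.mp hd]
      rw [key _ support_add, key f Finset.subset_union_left, key f' Finset.subset_union_right,
        ← Finset.sum_add_distrib]
      exact Finset.sum_congr rfl fun d _ => by rw [coeff_add, map_add]; ring)
    (fun c f g => by
      rw [Finset.sum_subset (support_smul (a := c) (f := f)) fun d _ hd => by
        rw [notMem_support_iff.mp hd]; simp]
      rw [smul_eq_mul, Finset.mul_sum]
      exact Finset.sum_congr rfl fun d _ => by rw [coeff_smul, smul_eq_mul, map_mul]; ring)
    (fun f g g' => by
      rw [← Finset.sum_add_distrib]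
      exact Finset.sum_congr rfl fun d _ => by rw [coeff_add]; ring)
    (fun c f g => by
      rw [RingHom.id_apply, smul_eq_mul, Finset.mul_sum]
      exact Finset.sum_congr rfl fun d _ => by rw [coeff_smul, smul_eq_mul]; ring)

theorem fockForm_apply (ν μ : ℝ) {f : Fock L} (g : Fock L)
    {s : Finset (Option (Fin (L + 1)) →₀ ℕ)} (hs : f.support ⊆ s) :
    fockForm L ν μ f g = ∑ d ∈ s, conj (coeff d f) * fockNorm L ν μ d * coeff d g :=
  Finset.sum_subset hs fun d _ hd => by simp [notMem_support_iff.mp hd]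

theorem fockForm_monomial (ν μ : ℝ) (d : Option (Fin (L + 1)) →₀ ℕ) (a : ℂ) (g : Fock L) :
    fockForm L ν μ (monomial d a) g = conj a * fockNorm L ν μ d * coeff d g := by
  rw [fockForm_apply ν μ g support_monomial_subset]
  simp

theorem fockForm_conj_symm (ν μ : ℝ) (f g : Fock L) :
    conj (fockForm L ν μ f g) = fockForm L ν μ g f := by
  classical
  rw [fockForm_apply ν μ g (Finset.subset_union_left (s₂ := g.support)),
    fockForm_apply ν μ f (Finset.subset_union_right (s₁ := f.support)), map_sum]
  exact Finset.sum_congr rfl fun d _ => by simp; ring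

/-- Adjointness of operators on the Fock space. -/
def FockAdjoint (ν μ : ℝ) (S T : Module.End ℂ (Fock L)) : Prop :=
  ∀ f g, fockForm L ν μ (S f) g = fockForm L ν μ f (T g)

namespace FockAdjoint

variable {ν μ : ℝ} {S T S' T' : Module.End ℂ (Fock L)}

theorem symm (h : FockAdjoint ν μ S T) : FockAdjoint ν μ T S := fun f g => by
  rw [← fockForm_conj_symm, ← h, fockForm_conj_symm]

theorem mul (h : FockAdjoint ν μ S T) (h' : FockAdjoint ν μ S' T') :
    FockAdjoint ν μ (S * S') (T' * T) := fun f g => by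
  rw [Module.End.mul_apply, Module.End.mul_apply, h, h']

theorem add (h : FockAdjoint ν μ S T) (h' : FockAdjoint ν μ S' T') :
    FockAdjoint ν μ (S + S') (T + T') := fun f g => by
  simp only [LinearMap.add_apply, map_add, h f g, h' f g]

theorem sub (h : FockAdjoint ν μ S T) (h' : FockAdjoint ν μ S' T') :
    FockAdjoint ν μ (S - S') (T - T') := fun f g => by
  simp only [LinearMap.sub_apply, map_sub, h f g, h' f g]

theorem smul (c : ℂ) (h : FockAdjoint ν μ S T) :
    FockAdjoint ν μ (c • S) (conj c • T) := fun f g => by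
  simp only [LinearMap.smul_apply, map_smul, LinearMap.map_smulₛₗ, h f g]

theorem sum {ι : Type*} (s : Finset ι) {F G : ι → Module.End ℂ (Fock L)}
    (h : ∀ i ∈ s, FockAdjoint ν μ (F i) (G i)) :
    FockAdjoint ν μ (∑ i ∈ s, F i) (∑ i ∈ s, G i) := fun f g => by
  simp only [LinearMap.sum_apply, map_sum]
  exact Finset.sum_congr rfl fun i hi => h i hi f g

theorem one : FockAdjoint (L := L) ν μ 1 1 := fun _ _ => rfl

/-- Additivity reduces adjointness to a monomial in the first argument, where the form reads off one
coefficient; what remains is the recursion of the norms. -/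
theorem mulX_left {i : Option (Fin (L + 1))}
    (h : ∀ d g, (fockNorm L ν μ (d + Finsupp.single i 1) : ℂ) *
      coeff (d + Finsupp.single i 1) g = fockNorm L ν μ d * coeff d (T g)) :
    FockAdjoint ν μ (mulX i) T := fun f g => by
  induction f using MvPolynomial.induction_on' with
  | add p q hp hq => simp only [map_add, LinearMap.add_apply, hp, hq]
  | monomial d a =>
    rw [mulX_apply, X, monomial_mul, one_mul, add_comm (Finsupp.single i 1) d, fockForm_monomial, fockForm_monomial,
      mul_assoc, mul_assoc, h]

end FockAdjoint

theorem fockAdjoint_mulX_some (ν μ : ℝ) (j : Fin (L + 1)) :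
    FockAdjoint ν μ (mulX (some j)) ((structI L (L - j) * μ) • dX (some j)) :=
  FockAdjoint.mulX_left fun d g => by
    rw [fockNorm_add_some, LinearMap.smul_apply, dX_apply, coeff_smul, coeff_pderiv, smul_eq_mul,
      ← coe_realI]
    push_cast
    ring

theorem fockAdjoint_slC (ν μ : ℝ) : FockAdjoint ν μ (slC L) (slH L ν) :=
  FockAdjoint.mulX_left fun d g => by
    classical
    rw [fockNorm_add_none, slH]
    simp only [LinearMap.sub_apply, LinearMap.smul_apply, Module.End.mul_apply, mulX_apply,
      dX_apply, coeff_sub, coeff_smul, coeff_X_mul', coeff_pderiv, smul_eq_mul]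
    split_ifs with h
    · rw [tsub_add_cancel_of_le (by
        rw [Finsupp.single_le_iff]; have := Finsupp.mem_support_iff.mp h; omega)]
      have h0 : d none ≠ 0 := Finsupp.mem_support_iff.mp h
      simp only [Finsupp.coe_tsub, Pi.sub_apply, Finsupp.single_eq_same]
      rw [Nat.cast_sub (by omega)]
      push_cast
      ring
    -- At `t`-degree `0` the second-order term of `slH` contributes nothing, in agreement with the
    -- recursion because its coefficient has the factor `d none`.
    · have h0 : d none = 0 := Finsupp.notMem_support_iff.mp h
      rw [h0]
      push_cast
      ring

theorem fockAdjoint_fockP (ν μ : ℝ) {n : ℕ} (hn : n ≤ 2 * L + 1) :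
    FockAdjoint ν μ (fockP L μ n) (fockP L μ (2 * L + 1 - n)) := by
  have high {n : ℕ} (hn : n ≤ 2 * L + 1) (h : L < n) :
      FockAdjoint ν μ (fockP L μ n) (fockP L μ (2 * L + 1 - n)) := by
    rw [fockP_high _ h (by omega), fockP_low _ (by omega),
      show L - (2 * L + 1 - n) = n - (L + 1) by omega]
    convert fockAdjoint_mulX_some ν μ (Fin.ofNat (L + 1) (n - (L + 1))) using 4
    simp only [Fin.ofNat]
    rw [Nat.mod_eq_of_lt (by omega)]
    omega
  rcases le_or_gt n L with h | h
  · have := (high (n := 2 * L + 1 - n) (by omega) (by omega)).symm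
    rwa [show 2 * L + 1 - (2 * L + 1 - n) = n by omega] at this
  · exact high hn h

theorem conj_oscCoeff (μ : ℝ) (n : ℕ) : conj (oscCoeff L μ n) = oscCoeff L μ n := by
  have h2 : conj (2 : ℂ) = 2 := map_ofNat _ 2
  simp [oscCoeff, h2]

/-- The adjoint of `p (n + 1) * p (2L + 1 - n)` is `p n * p (2L - n)`, the term of `oscH` with the
same real coefficient. -/
theorem fockAdjoint_oscC (ν μ : ℝ) :
    FockAdjoint ν μ (oscC L μ (fockP L μ)) (oscH L μ (fockP L μ)) := by
  refine FockAdjoint.sum _ fun n hn => ?_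
  rw [Finset.mem_range] at hn
  have h := ((fockAdjoint_fockP ν μ (show n + 1 ≤ 2 * L + 1 by omega)).mul
    (fockAdjoint_fockP ν μ (show 2 * L + 1 - n ≤ 2 * L + 1 by omega))).smul (oscCoeff L μ n)
  rwa [conj_oscCoeff, show 2 * L + 1 - (2 * L + 1 - n) = n by omega,
    show 2 * L + 1 - (n + 1) = 2 * L - n by omega] at h

theorem coe_slWeight (L : ℕ) (δ : ℝ) :
    ((δ + ((L : ℝ) + 1) ^ 2 / 2 : ℝ) : ℂ) = slWeight L δ := by
  simp [slWeight]

theorem fockAdjoint_fockGen (δ : ℝ) {μ : ℝ} (hμ : (μ : ℂ) ≠ 0) (a : Gen L) :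
    FockAdjoint (δ + ((L : ℝ) + 1) ^ 2 / 2) μ (fockGen L δ μ a) (fockGen L δ μ (omegaGen a)) := by
  have hC : FockAdjoint (δ + ((L : ℝ) + 1) ^ 2 / 2) μ (fockGen L δ μ .C) (fockGen L δ μ .H) := by
    have := (fockAdjoint_slC (L := L) (δ + ((L : ℝ) + 1) ^ 2 / 2) μ).add (fockAdjoint_oscC _ μ)
    rwa [coe_slWeight] at this
  cases a with
  | C => exact hC
  | H => exact hC.symm
  | D =>
    -- Self-adjointness of `D` comes from `D = [C, H]`: taking adjoints reverses products and
    -- exchanges `C` with `H`.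
    have h := fockRep_bracketGen (L := L) δ hμ .C .H
    rw [bracketGen, fockRep_gen, Ring.lie_def] at h
    rw [omegaGen, h]
    exact (hC.mul hC.symm).sub (hC.symm.mul hC)
  | M =>
    have := (FockAdjoint.one (L := L) (ν := δ + ((L : ℝ) + 1) ^ 2 / 2) (μ := μ)).smul (μ : ℂ)
    rwa [Complex.conj_ofReal] at this
  | P n =>
    have := fockAdjoint_fockP (L := L) (δ + ((L : ℝ) + 1) ^ 2 / 2) μ (n := n) (by omega)
    simp only [omegaGen, fockGen, Fin.val_rev]
    rwa [show 2 * L + 2 - ((n : ℕ) + 1) = 2 * L + 1 - n by omega]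

theorem omega_zero : omega (0 : CGA L) = 0 := by
  unfold omega
  erw [Finsupp.mapRange_zero, Finsupp.mapDomain_zero]
  rfl

theorem omega_add (x y : CGA L) : omega (x + y) = omega x + omega y := by
  unfold omega
  erw [Finsupp.mapRange_add (map_add _), Finsupp.mapDomain_add]
  rfl

theorem omega_smul_gen (c : ℂ) (a : Gen L) :
    omega (c • gen a) = conj c • gen (omegaGen a) := by
  unfold omega gen
  erw [Finsupp.smul_single, Finsupp.mapRange_single, Finsupp.mapDomain_single, Finsupp.smul_single]
  simp only [smul_eq_mul, mul_one]
  rfl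

theorem fockAdjoint_fockRep (δ : ℝ) {μ : ℝ} (hμ : (μ : ℂ) ≠ 0) (x : CGA L) :
    FockAdjoint (δ + ((L : ℝ) + 1) ^ 2 / 2) μ (fockRep L δ μ x) (fockRep L δ μ (omega x)) := by
  induction x using induction_gen with
  | h0 => rw [omega_zero, map_zero]; intro f g; simp
  | hadd x y hx hy => rw [omega_add, map_add, map_add]; exact hx.add hy
  | hgen c a =>
    rw [omega_smul_gen, map_smul, map_smul, fockRep_gen, fockRep_gen]
    exact (fockAdjoint_fockGen δ hμ a).smul c

/-- The Shapovalov form of the Verma module, for `μ ≠ 0`. -/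
def pullbackForm (L : ℕ) (δ : ℝ) {μ : ℝ} (hμ : (μ : ℂ) ≠ 0) :
    Verma L δ μ →ₗ⋆[ℂ] Verma L δ μ →ₗ[ℂ] ℂ :=
  LinearMap.mk₂'ₛₗ (starRingEnd ℂ) (RingHom.id ℂ)
    (fun x y => fockForm L (δ + ((L : ℝ) + 1) ^ 2 / 2) μ (vermaToFock L δ hμ x)
      (vermaToFock L δ hμ y))
    (fun x x' y => by rw [map_add, map_add, LinearMap.add_apply])
    (fun c x y => by rw [map_smul, LinearMap.map_smulₛₗ, LinearMap.smul_apply])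
    (fun x y y' => by rw [map_add, map_add])
    (fun c x y => by rw [map_smul, map_smul, RingHom.id_apply])

theorem pullbackForm_apply (δ : ℝ) {μ : ℝ} (hμ : (μ : ℂ) ≠ 0) (x y : Verma L δ μ) :
    pullbackForm L δ hμ x y = fockForm L (δ + ((L : ℝ) + 1) ^ 2 / 2) μ (vermaToFock L δ hμ x)
      (vermaToFock L δ hμ y) := rfl

theorem isShapovalov_pullbackForm (δ : ℝ) {μ : ℝ} (hμ : (μ : ℂ) ≠ 0) :
    IsShapovalov (pullbackForm L δ hμ) where
  hwv_hwv := by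
    have h : vermaToFock L δ hμ (hwv L δ μ) = 1 := by
      rw [← one_smul (U L) (hwv L δ μ), vermaToFock_smul_hwv, map_one (fockU L δ hμ),
        Module.End.one_apply]
    rw [pullbackForm_apply, h, one_def, fockForm_monomial]
    simp [fockNorm]
  contravariant A x y := by
    rw [pullbackForm_apply, pullbackForm_apply, vermaToFock_smul, vermaToFock_smul, fockU_toU,
      fockU_toU]
    exact fockAdjoint_fockRep δ hμ A _ _

end Form

end ConformalGalilei

namespace ConformalGalilei

/-! ### Splitting off lowering operators in the enveloping algebra. -/

section Spanning

variable {L : ℕ}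

theorem toU_add (x y : CGA L) : toU (x + y) = toU x + toU y := map_add _ x y

theorem toU_smul (c : ℂ) (x : CGA L) : toU (c • x) = c • toU x := map_smul _ c x

theorem toU_zero : toU (0 : CGA L) = 0 := map_zero _

section

attribute [local instance] LieRing.ofAssociativeRing

theorem toU_mul_toU (x y : CGA L) : toU x * toU y = toU y * toU x + toU (bracketMap L x y) := by
  have h : toU (bracketMap L x y) = toU x * toU y - toU y * toU x :=
    LieHom.map_lie (UniversalEnvelopingAlgebra.ι ℂ) x y
  rw [h]
  abel

end

theorem adjoin_range_toU : Algebra.adjoin ℂ (Set.range (toU : CGA L → U L)) = ⊤ := by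
  refine top_unique fun u hu => ?_
  clear hu
  obtain ⟨t, rfl⟩ : ∃ t, UniversalEnvelopingAlgebra.mkAlgHom ℂ (CGA L) t = u :=
    RingCon.mk'_surjective _ u
  induction t using TensorAlgebra.induction with
  | algebraMap r => rw [AlgHom.commutes]; exact Subalgebra.algebraMap_mem _ r
  | ι x => exact Algebra.subset_adjoin ⟨x, UniversalEnvelopingAlgebra.ι_apply ℂ x⟩
  | mul a b ha hb => rw [map_mul]; exact mul_mem ha hb
  | add a b ha hb => rw [map_add]; exact add_mem ha hb

theorem eq_top_of_mul_toU_mem (N : Submodule ℂ (U L)) (h1 : 1 ∈ N)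
    (h : ∀ u ∈ N, ∀ x, u * toU x ∈ N) : N = ⊤ := by
  refine top_unique fun u hu => ?_
  clear hu
  have key : ∀ v ∈ N, v * u ∈ N := by
    have hu : u ∈ Algebra.adjoin ℂ (Set.range (toU : CGA L → U L)) := by
      rw [adjoin_range_toU]; exact Algebra.mem_top
    induction hu using Algebra.adjoin_induction with
    | mem w hw => obtain ⟨x, rfl⟩ := hw; exact fun v hv => h v hv x
    | algebraMap r =>
      intro v hv
      rw [← Algebra.commutes, ← Algebra.smul_def]
      exact N.smul_mem r hv
    | add a b _ _ ha hb => intro v hv; rw [mul_add]; exact N.add_mem (ha v hv) (hb v hv)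
    | mul a b _ _ ha hb => intro v hv; rw [← mul_assoc]; exact hb _ (ha v hv)
  simpa using key 1 h1

theorem eq_top_of_toU_mul_mem (N : Submodule ℂ (U L)) (h1 : 1 ∈ N)
    (h : ∀ u ∈ N, ∀ x, toU x * u ∈ N) : N = ⊤ := by
  refine top_unique fun u hu => ?_
  clear hu
  have key : ∀ v ∈ N, u * v ∈ N := by
    have hu : u ∈ Algebra.adjoin ℂ (Set.range (toU : CGA L → U L)) := by
      rw [adjoin_range_toU]; exact Algebra.mem_top
    induction hu using Algebra.adjoin_induction with
    | mem w hw => obtain ⟨x, rfl⟩ := hw; exact fun v hv => h v hv x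
    | algebraMap r =>
      intro v hv
      rw [← Algebra.smul_def]
      exact N.smul_mem r hv
    | add a b _ _ ha hb => intro v hv; rw [add_mul]; exact N.add_mem (ha v hv) (hb v hv)
    | mul a b _ _ ha hb => intro v hv; rw [mul_assoc]; exact ha _ (hb v hv)
  simpa using key 1 h1

/-- The lowering generators `C, P_{ℓ + 1/2}, …, P_{2ℓ}`. -/
def IsLowering : Gen L → Prop
  | .C => True
  | .P n => L < n
  | _ => False

/-- The right ideal generated by the lowering generators. -/
def loweringIdeal (L : ℕ) : Submodule ℂ (U L) :=
  Submodule.span ℂ {w | ∃ a : Gen L, IsLowering a ∧ ∃ u, w = toU (gen a) * u}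

/-- The words in the generators that are not lowering. -/
def borelWords (L : ℕ) : Submonoid (U L) :=
  Submonoid.closure {w | ∃ a : Gen L, ¬ IsLowering a ∧ w = toU (gen a)}

theorem loweringIdeal_mul_mem {w : U L} (hw : w ∈ loweringIdeal L) (v : U L) :
    w * v ∈ loweringIdeal L := by
  induction hw using Submodule.span_induction with
  | mem x hx =>
    obtain ⟨a, ha, u, rfl⟩ := hx
    exact Submodule.subset_span ⟨a, ha, u * v, mul_assoc _ _ _⟩
  | zero => rw [zero_mul]; exact zero_mem _
  | add x y _ _ hx hy => rw [add_mul]; exact add_mem hx hy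
  | smul c x _ hx => rw [smul_mul_assoc]; exact Submodule.smul_mem _ c hx

theorem span_borelWords_mul_mem {w : U L} (hw : w ∈ Submodule.span ℂ (borelWords L : Set (U L)))
    {v : U L} (hv : v ∈ borelWords L) : w * v ∈ Submodule.span ℂ (borelWords L : Set (U L)) := by
  induction hw using Submodule.span_induction with
  | mem x hx => exact Submodule.subset_span (mul_mem hx hv)
  | zero => rw [zero_mul]; exact zero_mem _
  | add x y _ _ hx hy => rw [add_mul]; exact add_mem hx hy
  | smul c x _ hx => rw [smul_mul_assoc]; exact Submodule.smul_mem _ c hx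

/-- This is the spanning half of a triangular decomposition: every element is a sum of terms
starting with a lowering generator, plus words without lowering generators. No linear independence
is needed. -/
theorem loweringIdeal_sup_borel (L : ℕ) :
    loweringIdeal L ⊔ Submodule.span ℂ (borelWords L : Set (U L)) = ⊤ := by
  set N := loweringIdeal L ⊔ Submodule.span ℂ (borelWords L : Set (U L)) with hN
  have hR {w : U L} (hw : w ∈ loweringIdeal L) : w ∈ N := Submodule.mem_sup_left hw
  have hB {w : U L} (hw : w ∈ borelWords L) : w ∈ N :=
    Submodule.mem_sup_right (Submodule.subset_span hw)
  have hNB {w v : U L} (hw : w ∈ N) (hv : v ∈ borelWords L) : w * v ∈ N := by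
    obtain ⟨r, hr, b, hb, rfl⟩ := Submodule.mem_sup.mp hw
    rw [add_mul]
    exact add_mem (hR (loweringIdeal_mul_mem hr v))
      (Submodule.mem_sup_right (span_borelWords_mul_mem hb hv))
  have hword : ∀ w ∈ borelWords L, ∀ x : CGA L, w * toU x ∈ N := by
    intro w hw
    induction hw using Submonoid.closure_induction_right with
    | one =>
      intro x
      rw [one_mul]
      induction x using induction_gen with
      | h0 => rw [toU_zero]; exact zero_mem _
      | hadd x y hx hy => rw [toU_add]; exact add_mem hx hy
      | hgen c a =>
        rw [toU_smul]
        refine Submodule.smul_mem _ c ?_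
        by_cases ha : IsLowering a
        · exact hR (Submodule.subset_span ⟨a, ha, 1, (mul_one _).symm⟩)
        · exact hB (Submonoid.subset_closure ⟨a, ha, rfl⟩)
    | mul_right w _ b hb ih =>
      intro x
      obtain ⟨a, ha, rfl⟩ := hb
      -- `w a x = (w x) a + w [a, x]`: in both summands the shorter word `w` is followed by a single
      -- Lie algebra element, so the induction hypothesis, stated for all `x`, applies.
      rw [mul_assoc, toU_mul_toU, mul_add, ← mul_assoc]
      exact add_mem (hNB (ih x) (Submonoid.subset_closure ⟨a, ha, rfl⟩)) (ih _)
  refine eq_top_of_mul_toU_mem N (hB (one_mem _)) fun u hu x => ?_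
  obtain ⟨r, hr, b, hb, rfl⟩ := Submodule.mem_sup.mp hu
  rw [add_mul]
  refine add_mem (hR (loweringIdeal_mul_mem hr _)) ?_
  induction hb using Submodule.span_induction with
  | mem w hw => exact hword w hw x
  | zero => rw [zero_mul]; exact zero_mem _
  | add x y _ _ hx hy =>
    rw [add_mul]
    exact add_mem (hx (add_mem (hR hr) (Submodule.mem_sup_right ‹_›)))
      (hy (add_mem (hR hr) (Submodule.mem_sup_right ‹_›)))
  | smul c x _ hx =>
    rw [smul_mul_assoc]
    exact Submodule.smul_mem _ c (hx (add_mem (hR hr) (Submodule.mem_sup_right ‹_›)))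

end Spanning

/-! ### Matrix elements of Shapovalov forms as continuous functions of `μ`. -/

section Continuity

variable {L : ℕ} {δ μ : ℝ}

theorem toU_H_smul_hwv : toU (gen (.H : Gen L)) • hwv L δ μ = 0 :=
  (smul_hwv_eq_zero_iff _).mpr (Submodule.subset_span (Or.inl (Or.inl rfl)))

theorem toU_P_smul_hwv {n : ℕ} (hn : n ≤ L) : toU (pVec L n) • hwv L δ μ = 0 :=
  (smul_hwv_eq_zero_iff _).mpr (Submodule.subset_span (Or.inl (Or.inr ⟨n, hn, rfl⟩)))

theorem toU_D_smul_hwv : toU (gen (.D : Gen L)) • hwv L δ μ = (δ : ℂ) • hwv L δ μ := by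
  rw [← algebraMap_smul (U L) (δ : ℂ), ← sub_eq_zero, ← sub_smul]
  exact (smul_hwv_eq_zero_iff _).mpr (Submodule.subset_span (Or.inr (Or.inl rfl)))

theorem toU_M_smul_hwv : toU (gen (.M : Gen L)) • hwv L δ μ = (μ : ℂ) • hwv L δ μ := by
  rw [← algebraMap_smul (U L) (μ : ℂ), ← sub_eq_zero, ← sub_smul]
  exact (smul_hwv_eq_zero_iff _).mpr (Submodule.subset_span (Or.inr (Or.inr rfl)))

theorem omegaGen_omegaGen (a : Gen L) : omegaGen (omegaGen a) = a := by
  cases a <;> simp [omegaGen]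

theorem omega_gen (a : Gen L) : omega (gen a) = gen (omegaGen a) := by
  have := omega_smul_gen 1 a
  rwa [one_smul, map_one, one_smul] at this

theorem IsShapovalov.gen_right {B : Verma L δ μ →ₗ⋆[ℂ] Verma L δ μ →ₗ[ℂ] ℂ} (hB : IsShapovalov B)
    (a : Gen L) (x y : Verma L δ μ) :
    B x (toU (gen a) • y) = B (toU (gen (omegaGen a)) • x) y := by
  rw [hB.contravariant, omega_gen, omegaGen_omegaGen]

theorem omegaGen_smul_hwv {a : Gen L} (ha : IsLowering a) :
    toU (gen (omegaGen a)) • hwv L δ μ = 0 := by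
  cases a with
  | C => exact toU_H_smul_hwv
  | P n =>
    rw [omegaGen, gen_P]
    refine toU_P_smul_hwv ?_
    rw [Fin.val_rev]
    simp only [IsLowering] at ha
    omega
  | D => exact ha.elim
  | H => exact ha.elim
  | M => exact ha.elim

/-- The vacuum expectation values of a fixed element depend continuously on `μ`. -/
theorem exists_continuous_vacuum (δ : ℝ) (u : U L) : ∃ g : ℝ → ℂ, Continuous g ∧
    ∀ (μ : ℝ) (B : Verma L δ μ →ₗ⋆[ℂ] Verma L δ μ →ₗ[ℂ] ℂ), IsShapovalov B →
      B (hwv L δ μ) (u • hwv L δ μ) = g μ := by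
  have hu : u ∈ loweringIdeal L ⊔ Submodule.span ℂ (borelWords L : Set (U L)) := by
    rw [loweringIdeal_sup_borel]; trivial
  obtain ⟨r, hr, b, hb, rfl⟩ := Submodule.mem_sup.mp hu
  -- A leading lowering generator moves to the left argument as its image under `ω`, which
  -- annihilates the highest weight vector.
  have hr' (μ : ℝ) (B : Verma L δ μ →ₗ⋆[ℂ] Verma L δ μ →ₗ[ℂ] ℂ) (hB : IsShapovalov B) :
      B (hwv L δ μ) (r • hwv L δ μ) = 0 := by
    induction hr using Submodule.span_induction with
    | mem x hx =>
      obtain ⟨a, ha, u, rfl⟩ := hx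
      rw [mul_smul, hB.gen_right, omegaGen_smul_hwv ha, map_zero, LinearMap.zero_apply]
    | zero => simp
    | add x y _ _ hx hy =>
      rw [add_smul, map_add, hx (Submodule.mem_sup.mpr ⟨_, ‹_›, _, hb, rfl⟩),
        hy (Submodule.mem_sup.mpr ⟨_, ‹_›, _, hb, rfl⟩), add_zero]
    | smul c x _ hx =>
      rw [smul_assoc, map_smul, hx (Submodule.mem_sup.mpr ⟨_, ‹_›, _, hb, rfl⟩), smul_zero]
  suffices h : ∃ g : ℝ → ℂ, Continuous g ∧
      ∀ (μ : ℝ) (B : Verma L δ μ →ₗ⋆[ℂ] Verma L δ μ →ₗ[ℂ] ℂ), IsShapovalov B →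
        B (hwv L δ μ) (b • hwv L δ μ) = g μ by
    obtain ⟨g, hg, h⟩ := h
    exact ⟨g, hg, fun μ B hB => by rw [add_smul, map_add, hr' μ B hB, h μ B hB, zero_add]⟩
  clear hu hr hr'
  induction hb using Submodule.span_induction with
  | zero => exact ⟨0, continuous_const, fun μ B _ => by simp⟩
  | add x y _ _ hx hy =>
    obtain ⟨g, hg, hx⟩ := hx
    obtain ⟨g', hg', hy⟩ := hy
    exact ⟨fun μ => g μ + g' μ, hg.add hg', fun μ B hB => by
      rw [add_smul, map_add, hx μ B hB, hy μ B hB]⟩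
  | smul c x _ hx =>
    obtain ⟨g, hg, hx⟩ := hx
    exact ⟨fun μ => c * g μ, continuous_const.mul hg, fun μ B hB => by
      rw [smul_assoc, map_smul, hx μ B hB, smul_eq_mul]⟩
  | mem w hw =>
    -- The last letter of the word acts on the highest weight vector by `δ`, `μ` or `0`, so each
    -- letter multiplies the value by a continuous function of `μ` that does not depend on `B`.
    induction hw using Submonoid.closure_induction_right with
    | one => exact ⟨fun _ => 1, continuous_const, fun μ B hB => by rw [one_smul, hB.hwv_hwv]⟩
    | mul_right w _ b hb ih =>
      obtain ⟨g, hg, ih⟩ := ih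
      obtain ⟨a, ha, rfl⟩ := hb
      cases a with
      | C => exact absurd trivial ha
      | D =>
        exact ⟨fun μ => δ * g μ, continuous_const.mul hg, fun μ B hB => by
          rw [mul_smul, toU_D_smul_hwv, smul_comm, map_smul, ih μ B hB, smul_eq_mul]⟩
      | M =>
        exact ⟨fun μ => μ * g μ, Complex.continuous_ofReal.mul hg, fun μ B hB => by
          rw [mul_smul, toU_M_smul_hwv, smul_comm, map_smul, ih μ B hB, smul_eq_mul]⟩
      | H =>
        exact ⟨fun _ => 0, continuous_const, fun μ B hB => by
          rw [mul_smul, toU_H_smul_hwv, smul_zero, map_zero]⟩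
      | P n =>
        exact ⟨fun _ => 0, continuous_const, fun μ B hB => by
          rw [mul_smul, gen_P, toU_P_smul_hwv (not_lt.mp ha), smul_zero, map_zero]⟩

/-- The values of the Shapovalov form depend continuously on `μ`, and they determine the form. -/
theorem exists_continuous_form (δ : ℝ) (x y : U L) : ∃ g : ℝ → ℂ, Continuous g ∧
    ∀ (μ : ℝ) (B : Verma L δ μ →ₗ⋆[ℂ] Verma L δ μ →ₗ[ℂ] ℂ), IsShapovalov B →
      B (x • hwv L δ μ) (y • hwv L δ μ) = g μ := by
  -- The elements `x` for which the claim holds with every `y`. Contravariance moves a left factor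
  -- of `x` over to `y`, so `N` is stable under left multiplication by the algebra and contains
  -- everything once it contains `1`.
  let N : Submodule ℂ (U L) :=
    { carrier := {x | ∀ y : U L, ∃ g : ℝ → ℂ, Continuous g ∧
        ∀ (μ : ℝ) (B : Verma L δ μ →ₗ⋆[ℂ] Verma L δ μ →ₗ[ℂ] ℂ), IsShapovalov B →
          B (x • hwv L δ μ) (y • hwv L δ μ) = g μ}
      zero_mem' := fun y => ⟨fun _ => 0, continuous_const, fun μ B _ => by
        rw [zero_smul, map_zero, LinearMap.zero_apply]⟩
      add_mem' := fun {x x'} hx hx' y => by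
        obtain ⟨g, hg, hx⟩ := hx y
        obtain ⟨g', hg', hx'⟩ := hx' y
        exact ⟨fun μ => g μ + g' μ, hg.add hg', fun μ B hB => by
          rw [add_smul, map_add, LinearMap.add_apply, hx μ B hB, hx' μ B hB]⟩
      smul_mem' := fun c x hx y => by
        obtain ⟨g, hg, hx⟩ := hx y
        exact ⟨fun μ => conj c * g μ, continuous_const.mul hg, fun μ B hB => by
          rw [smul_assoc, LinearMap.map_smulₛₗ, LinearMap.smul_apply, hx μ B hB, smul_eq_mul]⟩ }
  have hN : N = ⊤ := eq_top_of_toU_mul_mem N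
    (fun y => by
      obtain ⟨g, hg, h⟩ := exists_continuous_vacuum δ y
      exact ⟨g, hg, fun μ B hB => by rw [one_smul, h μ B hB]⟩)
    (fun u hu A y => by
      obtain ⟨g, hg, h⟩ := hu (toU (omega A) * y)
      exact ⟨g, hg, fun μ B hB => by
        rw [mul_smul, hB.contravariant, ← mul_smul, h μ B hB]⟩)
  have hx : x ∈ N := by rw [hN]; trivial
  exact hx y

/-- The values of the Shapovalov form as functions of `μ`. -/
def shapovalovFn (δ : ℝ) (x y : U L) : ℝ → ℂ := (exists_continuous_form δ x y).choose

theorem continuous_shapovalovFn (δ : ℝ) (x y : U L) : Continuous (shapovalovFn δ x y) :=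
  (exists_continuous_form δ x y).choose_spec.1

theorem IsShapovalov.apply_eq {B : Verma L δ μ →ₗ⋆[ℂ] Verma L δ μ →ₗ[ℂ] ℂ} (hB : IsShapovalov B)
    (x y : U L) : B (x • hwv L δ μ) (y • hwv L δ μ) = shapovalovFn δ x y μ :=
  (exists_continuous_form δ x y).choose_spec.2 μ B hB

/-- This carries identities to `μ = 0`: they are checked where the Fock space is available, and the
punctured line is dense. -/
theorem eq_of_eq_of_ne_zero {g g' : ℝ → ℂ} (hg : Continuous g) (hg' : Continuous g')
    (h : ∀ μ : ℝ, μ ≠ 0 → g μ = g' μ) (μ : ℝ) : g μ = g' μ :=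
  congr_fun (hg.ext_on (dense_compl_singleton (0 : ℝ)) hg' fun x hx => h x hx) μ

end Continuity

/-! ### Existence of the Shapovalov form for all parameters, including `μ = 0`. -/

section Existence

variable {L : ℕ} {δ : ℝ}

theorem shapovalovFn_eq_pullbackForm {μ : ℝ} (hμ : μ ≠ 0) (x y : U L) :
    shapovalovFn δ x y μ = pullbackForm L δ (Complex.ofReal_ne_zero.mpr hμ)
      (x • hwv L δ μ) (y • hwv L δ μ) :=
  ((isShapovalov_pullbackForm δ (Complex.ofReal_ne_zero.mpr hμ)).apply_eq x y).symm

theorem shapovalovFn_one_one (μ : ℝ) : shapovalovFn δ (1 : U L) 1 μ = 1 := by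
  refine eq_of_eq_of_ne_zero (continuous_shapovalovFn _ _ _) continuous_const (fun μ hμ => ?_) μ
  rw [shapovalovFn_eq_pullbackForm hμ, one_smul]
  exact (isShapovalov_pullbackForm δ _).hwv_hwv

theorem shapovalovFn_conj (x y : U L) (μ : ℝ) :
    conj (shapovalovFn δ x y μ) = shapovalovFn δ y x μ := by
  refine eq_of_eq_of_ne_zero (Complex.continuous_conj.comp (continuous_shapovalovFn _ _ _))
    (continuous_shapovalovFn _ _ _) (fun μ hμ => ?_) μ
  rw [Function.comp_apply, shapovalovFn_eq_pullbackForm hμ, shapovalovFn_eq_pullbackForm hμ]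
  exact fockForm_conj_symm _ _ _ _

theorem shapovalovFn_add_right (x y y' : U L) (μ : ℝ) :
    shapovalovFn δ x (y + y') μ = shapovalovFn δ x y μ + shapovalovFn δ x y' μ := by
  refine eq_of_eq_of_ne_zero
    (g' := fun μ => shapovalovFn δ x y μ + shapovalovFn δ x y' μ) (continuous_shapovalovFn _ _ _)
    ((continuous_shapovalovFn _ _ _).add (continuous_shapovalovFn _ _ _)) (fun μ hμ => ?_) μ
  simp only [shapovalovFn_eq_pullbackForm hμ, add_smul, map_add]

theorem shapovalovFn_smul_right (c : ℂ) (x y : U L) (μ : ℝ) :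
    shapovalovFn δ x (c • y) μ = c * shapovalovFn δ x y μ := by
  refine eq_of_eq_of_ne_zero (g' := fun μ => c * shapovalovFn δ x y μ)
    (continuous_shapovalovFn _ _ _) (continuous_const.mul (continuous_shapovalovFn _ _ _)) (fun μ hμ => ?_) μ
  simp only [shapovalovFn_eq_pullbackForm hμ, smul_assoc, map_smul, smul_eq_mul]

theorem shapovalovFn_add_left (x x' y : U L) (μ : ℝ) :
    shapovalovFn δ (x + x') y μ = shapovalovFn δ x y μ + shapovalovFn δ x' y μ := by
  rw [← shapovalovFn_conj y, ← shapovalovFn_conj y, ← shapovalovFn_conj y, shapovalovFn_add_right,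
    map_add]

theorem shapovalovFn_smul_left (c : ℂ) (x y : U L) (μ : ℝ) :
    shapovalovFn δ (c • x) y μ = conj c * shapovalovFn δ x y μ := by
  rw [← shapovalovFn_conj y, ← shapovalovFn_conj y, shapovalovFn_smul_right, map_mul]

theorem shapovalovFn_contravariant (A : CGA L) (x y : U L) (μ : ℝ) :
    shapovalovFn δ (toU A * x) y μ = shapovalovFn δ x (toU (omega A) * y) μ := by
  refine eq_of_eq_of_ne_zero (continuous_shapovalovFn _ _ _) (continuous_shapovalovFn _ _ _)
    (fun μ hμ => ?_) μ
  rw [shapovalovFn_eq_pullbackForm hμ, shapovalovFn_eq_pullbackForm hμ, mul_smul, mul_smul]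
  exact (isShapovalov_pullbackForm δ _).contravariant _ _ _

theorem shapovalovFn_eq_zero_of_smul_hwv {x : U L} (h : ∀ μ : ℝ, x • hwv L δ μ = 0) (y : U L)
    (μ : ℝ) : shapovalovFn δ x y μ = 0 := by
  refine eq_of_eq_of_ne_zero (continuous_shapovalovFn _ _ _) continuous_const (fun μ hμ => ?_) μ
  rw [shapovalovFn_eq_pullbackForm hμ, h, map_zero, LinearMap.zero_apply]

/-- The defining left ideal lies in the left radical at the same parameter; this is what lets the
limiting values descend to the Verma module, in particular at `μ = 0`. -/
theorem shapovalovFn_eq_zero_of_mem {μ : ℝ} {x : U L} (hx : x ∈ vermaIdeal L δ μ) (y : U L) :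
    shapovalovFn δ x y μ = 0 := by
  have hzero (y : U L) : shapovalovFn δ 0 y μ = 0 := by
    have := shapovalovFn_smul_left (δ := δ) 0 (0 : U L) y μ
    rwa [zero_smul, map_zero, zero_mul] at this
  unfold vermaIdeal at hx
  induction hx using Submodule.span_induction generalizing y with
  | zero => exact hzero y
  | add x x' _ _ hx hx' => rw [shapovalovFn_add_left, hx, hx', add_zero]
  | smul a x _ hx =>
    -- The left multipliers `a` that keep `x` in the radical. By contravariance a further left
    -- factor is absorbed into `y`, so all of the enveloping algebra qualifies.
    let N : Submodule ℂ (U L) :=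
      { carrier := {a | ∀ y, shapovalovFn δ (a * x) y μ = 0}
        zero_mem' := fun y => by rw [zero_mul, hzero]
        add_mem' := fun {a b} ha hb y => by
          rw [add_mul, shapovalovFn_add_left, ha, hb, add_zero]
        smul_mem' := fun c a ha y => by
          rw [smul_mul_assoc, shapovalovFn_smul_left, ha, mul_zero] }
    have hN : N = ⊤ := eq_top_of_toU_mul_mem N (fun y => by rw [one_mul]; exact hx y)
      (fun u hu A y => by rw [mul_assoc, shapovalovFn_contravariant]; exact hu _)
    have ha : a ∈ N := by rw [hN]; trivial
    exact ha y
  | mem x hx =>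
    rcases hx with (hx | ⟨n, hn, hx⟩) | hx | hx
    · rw [hx]; exact shapovalovFn_eq_zero_of_smul_hwv (fun μ => toU_H_smul_hwv) y μ
    · rw [hx]; exact shapovalovFn_eq_zero_of_smul_hwv (fun μ => toU_P_smul_hwv hn) y μ
    · rw [hx]
      refine shapovalovFn_eq_zero_of_smul_hwv (fun μ => ?_) y μ
      rw [sub_smul, toU_D_smul_hwv, algebraMap_smul, sub_self]
    · rw [hx]
      -- `M - μ` kills the highest weight vector only at the parameter `μ` itself. With `μ` fixed
      -- and the parameter `ν` varying, it acts by `ν - μ`; the factorization extends to all `ν` by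
      -- continuity and vanishes at `ν = μ`.
      have h := eq_of_eq_of_ne_zero
        (continuous_shapovalovFn δ (toU (gen .M) - algebraMap ℂ (U L) (μ : ℂ)) y)
        (g' := fun ν => ((ν : ℂ) - μ) * shapovalovFn δ 1 y ν)
        ((Complex.continuous_ofReal.sub continuous_const).mul (continuous_shapovalovFn _ _ _))
        (fun ν hν => by
          rw [shapovalovFn_eq_pullbackForm hν, shapovalovFn_eq_pullbackForm hν, sub_smul,
            toU_M_smul_hwv, algebraMap_smul, ← sub_smul, LinearMap.map_smulₛₗ,
            LinearMap.smul_apply, one_smul, map_sub, Complex.conj_ofReal, Complex.conj_ofReal,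
            smul_eq_mul]) μ
      rw [h, sub_self, zero_mul]

theorem shapovalovFn_congr {μ : ℝ} {x x' y y' : U L} (hx : x • hwv L δ μ = x' • hwv L δ μ)
    (hy : y • hwv L δ μ = y' • hwv L δ μ) :
    shapovalovFn δ x y μ = shapovalovFn δ x' y' μ := by
  have left {x x' : U L} (hx : x • hwv L δ μ = x' • hwv L δ μ) (y : U L) :
      shapovalovFn δ x y μ = shapovalovFn δ x' y μ := by
    rw [← sub_eq_zero, ← sub_smul, smul_hwv_eq_zero_iff] at hx
    have h := shapovalovFn_eq_zero_of_mem hx y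
    have h' := shapovalovFn_add_left (δ := δ) (x - x') x' y μ
    rwa [sub_add_cancel, h, zero_add] at h'
  rw [left hx, ← shapovalovFn_conj y, left hy, shapovalovFn_conj]

/-- The form is `shapovalovFn` on chosen representatives; independence of the choice is
`shapovalovFn_congr`, and the axioms are inherited from the identities for `shapovalovFn`. -/
theorem exists_isShapovalov (L : ℕ) (δ μ : ℝ) :
    ∃ B : Verma L δ μ →ₗ⋆[ℂ] Verma L δ μ →ₗ[ℂ] ℂ, IsShapovalov B := by
  choose out hout using fun x : Verma L δ μ => exists_smul_hwv x
  have key (u w : U L) : shapovalovFn δ (out (u • hwv L δ μ)) (out (w • hwv L δ μ)) μ =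
      shapovalovFn δ u w μ := shapovalovFn_congr (hout _).symm (hout _).symm
  refine ⟨LinearMap.mk₂'ₛₗ (starRingEnd ℂ) (RingHom.id ℂ)
    (fun x y => shapovalovFn δ (out x) (out y) μ) ?_ ?_ ?_ ?_, ?_, ?_⟩
  · intro x x' y
    obtain ⟨u, rfl⟩ := exists_smul_hwv x
    obtain ⟨u', rfl⟩ := exists_smul_hwv x'
    obtain ⟨w, rfl⟩ := exists_smul_hwv y
    rw [← add_smul, key, key, key, shapovalovFn_add_left]
  · intro c x y
    obtain ⟨u, rfl⟩ := exists_smul_hwv x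
    obtain ⟨w, rfl⟩ := exists_smul_hwv y
    rw [← smul_assoc, key, key, shapovalovFn_smul_left, smul_eq_mul]
  · intro x y y'
    obtain ⟨u, rfl⟩ := exists_smul_hwv x
    obtain ⟨w, rfl⟩ := exists_smul_hwv y
    obtain ⟨w', rfl⟩ := exists_smul_hwv y'
    rw [← add_smul, key, key, key, shapovalovFn_add_right]
  · intro c x y
    obtain ⟨u, rfl⟩ := exists_smul_hwv x
    obtain ⟨w, rfl⟩ := exists_smul_hwv y
    rw [← smul_assoc, key, key, shapovalovFn_smul_right, smul_eq_mul, RingHom.id_apply]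
  · have := key 1 1
    rw [one_smul, shapovalovFn_one_one] at this
    exact this
  · intro A x y
    obtain ⟨u, rfl⟩ := exists_smul_hwv x
    obtain ⟨w, rfl⟩ := exists_smul_hwv y
    rw [smul_smul, smul_smul]
    exact (key _ _).trans ((shapovalovFn_contravariant A u w μ).trans (key _ _).symm)

end Existence

end ConformalGalilei

namespace ConformalGalilei

open MvPolynomial

/-! ### Labels as exponents of monomials, graded by level. -/

section Labels

variable {L : ℕ}

/-- The level of a generator of the Fock space. -/
def varLevel {L : ℕ} : Option (Fin (L + 1)) → ℕ
  | none => 2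
  | some j => 2 * j + 1

/-- The level of a monomial of the Fock space. -/
def level (d : Option (Fin (L + 1)) →₀ ℕ) : ℕ := ∑ o, varLevel o * d o

theorem level_add (d e : Option (Fin (L + 1)) →₀ ℕ) : level (d + e) = level d + level e := by
  simp [level, mul_add, Finset.sum_add_distrib]

theorem level_single (o : Option (Fin (L + 1))) (n : ℕ) :
    level (Finsupp.single o n) = varLevel o * n := by
  classical
  rw [level, Finset.sum_eq_single o]
  · simp
  · intro b _ hb
    rw [Finsupp.single_eq_of_ne hb, mul_zero]
  · intro h
    exact absurd (Finset.mem_univ o) h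

/-- The exponents of the monomial `t^h x_0^{k_0} ⋯ x_L^{k_L}`. -/
def monoExp (h : ℕ) (k : Fin (L + 1) → ℕ) : Option (Fin (L + 1)) →₀ ℕ :=
  Finsupp.equivFunOnFinite.symm fun o => o.elim h k

@[simp]
theorem monoExp_none (h : ℕ) (k : Fin (L + 1) → ℕ) : monoExp h k none = h := rfl

@[simp]
theorem monoExp_some (h : ℕ) (k : Fin (L + 1) → ℕ) (j : Fin (L + 1)) :
    monoExp h k (some j) = k j := rfl

theorem level_monoExp (h : ℕ) (k : Fin (L + 1) → ℕ) :
    level (monoExp h k) = 2 * h + ∑ j : Fin (L + 1), (2 * (j : ℕ) + 1) * k j := by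
  rw [level, Fintype.sum_option]
  rfl

theorem monoExp_succ (h : ℕ) (k : Fin (L + 1) → ℕ) :
    monoExp (h + 1) k = Finsupp.single none 1 + monoExp h k := by
  ext o
  cases o <;> simp [add_comm]

/-- The exponents of the monomial of a label. -/
def labelExp {m : ℕ} (a : Label L m) : Option (Fin (L + 1)) →₀ ℕ := monoExp a.1.1 a.1.2

theorem labelExp_injective (m : ℕ) : Function.Injective (labelExp : Label L m → _) := by
  intro a b hab
  refine Subtype.ext (Prod.ext ?_ (funext fun j => ?_))
  · exact DFunLike.congr_fun hab none
  · exact DFunLike.congr_fun hab (some j)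

theorem level_labelExp {m : ℕ} (a : Label L m) : level (labelExp a) = m := by
  rw [labelExp, level_monoExp, a.2]

theorem exists_labelExp_eq {m : ℕ} {d : Option (Fin (L + 1)) →₀ ℕ} (hd : level d = m) :
    ∃ a : Label L m, labelExp a = d := by
  have h : monoExp (d none) (fun j => d (some j)) = d := by
    ext o; cases o <;> rfl
  refine ⟨⟨(d none, fun j => d (some j)), ?_⟩, h⟩
  rw [← level_monoExp, h, hd]

end Labels

/-! ### Images of the basis vectors and their leading monomials. -/

section Leading

variable {L : ℕ}

theorem exists_coeff_mulX_ne_zero {i : Option (Fin (L + 1))} {f : Fock L}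
    {d : Option (Fin (L + 1)) →₀ ℕ} (hd : coeff d (mulX i f) ≠ 0) :
    ∃ e, coeff e f ≠ 0 ∧ d = Finsupp.single i 1 + e := by
  classical
  rw [mulX_apply, coeff_X_mul'] at hd
  split_ifs at hd with h
  · refine ⟨_, hd, (add_tsub_cancel_of_le ?_).symm⟩
    rw [Finsupp.single_le_iff]
    exact Nat.one_le_iff_ne_zero.mpr (Finsupp.mem_support_iff.mp h)
  · exact absurd rfl hd

/-- `P_n` preserves the degree in `t` and shifts the level by `2n - (2L + 1)`; the equation is
arranged to avoid subtraction of naturals. -/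
theorem exists_coeff_fockP_ne_zero {μ : ℂ} {n : ℕ} {f : Fock L}
    {d : Option (Fin (L + 1)) →₀ ℕ} (hd : coeff d (fockP L μ n f) ≠ 0) :
    ∃ e, coeff e f ≠ 0 ∧ d none = e none ∧ level d + (2 * L + 1) = level e + 2 * n := by
  rcases le_or_gt n L with h | h
  · rw [fockP_low μ h, LinearMap.smul_apply, coeff_smul, smul_eq_mul, dX_apply, coeff_pderiv] at hd
    refine ⟨_, left_ne_zero_of_mul (right_ne_zero_of_mul hd), by simp, ?_⟩
    rw [level_add, level_single]
    simp only [varLevel, Fin.ofNat]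
    rw [Nat.mod_eq_of_lt (by omega)]
    omega
  · rcases lt_or_ge n (2 * L + 2) with h' | h'
    · rw [fockP_high μ h h'] at hd
      obtain ⟨e, he, rfl⟩ := exists_coeff_mulX_ne_zero hd
      refine ⟨e, he, by simp, ?_⟩
      rw [level_add, level_single]
      simp only [varLevel, Fin.ofNat]
      rw [Nat.mod_eq_of_lt (by omega)]
      omega
    · rw [fockP_zero μ h'] at hd
      simp at hd

theorem exists_coeff_oscC_ne_zero {μ : ℂ} {f : Fock L}
    {d : Option (Fin (L + 1)) →₀ ℕ} (hd : coeff d (oscC L μ (fockP L μ) f) ≠ 0) :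
    ∃ e, coeff e f ≠ 0 ∧ d none = e none ∧ level d = level e + 2 := by
  rw [oscC, LinearMap.sum_apply, coeff_sum] at hd
  obtain ⟨n, hn, hd⟩ := Finset.exists_ne_zero_of_sum_ne_zero hd
  rw [Finset.mem_range] at hn
  rw [LinearMap.smul_apply, coeff_smul, Module.End.mul_apply] at hd
  obtain ⟨e, he, h1, h2⟩ := exists_coeff_fockP_ne_zero (right_ne_zero_of_mul hd)
  obtain ⟨e', he', h3, h4⟩ := exists_coeff_fockP_ne_zero he
  exact ⟨e', he', h1.trans h3, by omega⟩

/-- Of the two summands of `C`, multiplication by `t` raises the degree in `t` and the quadratic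
part does not, while both raise the level by `2`. Hence the term of degree `h` in `t` is a single
monomial with coefficient `1`. -/
theorem fockC_pow_monomial (μ : ℂ) (h : ℕ) (k : Fin (L + 1) → ℕ) :
    ∃ g : Fock L, ((slC L + oscC L μ (fockP L μ)) ^ h) (monomial (monoExp 0 k) 1) =
      monomial (monoExp h k) 1 + g ∧
      ∀ d, coeff d g ≠ 0 → d none < h ∧ level d = level (monoExp h k) := by
  induction h with
  | zero => exact ⟨0, by simp, fun d hd => by simp at hd⟩
  | succ h ih =>
    obtain ⟨g, hg, hsupp⟩ := ih
    refine ⟨slC L g + oscC L μ (fockP L μ) (monomial (monoExp h k) 1 + g), ?_, fun d hd => ?_⟩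
    · rw [pow_succ', Module.End.mul_apply, hg, LinearMap.add_apply, map_add, slC, mulX_apply, X,
        monomial_mul, one_mul, ← monoExp_succ, add_assoc]
    · have hlev : level (monoExp (h + 1) k) = level (monoExp h k) + 2 := by
        rw [level_monoExp, level_monoExp]; ring
      rw [hlev]
      rw [coeff_add] at hd
      by_cases h1 : coeff d (slC L g) = 0
      · rw [h1, zero_add] at hd
        obtain ⟨e, he, h2, h3⟩ := exists_coeff_oscC_ne_zero hd
        rw [coeff_add] at he
        by_cases h4 : coeff e g = 0
        · rw [h4, add_zero] at he
          have h5 : monoExp h k = e := by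
            classical
            rw [coeff_monomial] at he
            by_contra h6
            exact he (if_neg h6)
          rw [h2, h3, ← h5]
          exact ⟨by simp, rfl⟩
        · obtain ⟨h5, h6⟩ := hsupp e h4
          omega
      · obtain ⟨e, he, h2⟩ := exists_coeff_mulX_ne_zero h1
        obtain ⟨h5, h6⟩ := hsupp e he
        rw [h2, level_add, level_single]
        simp only [Finsupp.add_apply, Finsupp.single_eq_same, varLevel]
        omega

theorem prod_mulX (k : Fin (L + 1) → ℕ) :
    (List.ofFn fun j : Fin (L + 1) => (mulX (some j) : Module.End ℂ (Fock L)) ^ k j).prod 1 =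
      monomial (monoExp 0 k) 1 := by
  have h (j : Fin (L + 1)) : (mulX (some j) : Module.End ℂ (Fock L)) ^ k j =
      Algebra.lmul ℂ (Fock L) (X (some j) ^ k j) := by
    rw [map_pow]; rfl
  have h' : (List.ofFn fun j : Fin (L + 1) => (mulX (some j) : Module.End ℂ (Fock L)) ^ k j) =
      (List.ofFn fun j : Fin (L + 1) => (X (some j) ^ k j : Fock L)).map
        (Algebra.lmul ℂ (Fock L)) := by
    rw [List.map_ofFn]
    congr 1
    funext j
    exact h j
  rw [h', ← map_list_prod, List.prod_ofFn]
  change (∏ j, X (some j) ^ k j : Fock L) * 1 = _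
  rw [mul_one, monomial_eq]
  rw [Finsupp.prod_fintype _ _ (fun _ => pow_zero _), Fintype.prod_option]
  simp

/-- The element of the enveloping algebra creating a basis vector. -/
def basisWord {m : ℕ} (a : Label L m) : U L :=
  toU (gen .C) ^ a.1.1 *
    (List.ofFn fun j : Fin (L + 1) => toU (pVec L (L + 1 + (j : ℕ))) ^ a.1.2 j).prod

theorem fockP_high_fin (μ : ℂ) (j : Fin (L + 1)) : fockP L μ (L + 1 + j) = mulX (some j) := by
  rw [fockP_high μ (by omega) (by omega)]
  congr 2
  ext
  simp only [Fin.ofNat]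
  rw [Nat.mod_eq_of_lt (by omega)]
  omega

theorem vermaToFock_basisVec (δ : ℝ) {μ : ℝ} (hμ : (μ : ℂ) ≠ 0) {m : ℕ} (a : Label L m) :
    vermaToFock L δ hμ (basisVec δ μ a) =
      ((slC L + oscC L μ (fockP L μ)) ^ a.1.1) (monomial (monoExp 0 a.1.2) 1) := by
  have h : vermaToFock L δ hμ (basisVec δ μ a) = fockU L δ hμ (basisWord a) 1 :=
    vermaToFock_smul_hwv δ hμ (basisWord a)
  have h2 : fockU L δ hμ (List.ofFn fun j : Fin (L + 1) =>
      toU (pVec L (L + 1 + (j : ℕ))) ^ a.1.2 j).prod =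
      (List.ofFn fun j : Fin (L + 1) => (mulX (some j) : Module.End ℂ (Fock L)) ^ a.1.2 j).prod := by
    rw [map_list_prod, List.map_ofFn]
    congr 2
    funext j
    rw [Function.comp_apply, map_pow, fockU_toU, fockRep_pVec, fockP_high_fin]
  rw [h, basisWord, map_mul, map_pow, fockU_toU, fockRep_gen, fockGen, h2, Module.End.mul_apply,
    prod_mulX]

end Leading

/-! ### The Kac determinant as a product of norms. -/

section Determinant

variable {L : ℕ}

/-- The matrix of coefficients of the images of the basis vectors in the Fock space. -/
def transitionMatrix (L m : ℕ) (δ : ℝ) {μ : ℝ} (hμ : (μ : ℂ) ≠ 0) :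
    Matrix (Label L m) (Label L m) ℂ :=
  Matrix.of fun c a => coeff (labelExp c) (vermaToFock L δ hμ (basisVec δ μ a))

theorem transitionMatrix_apply_of_le (m : ℕ) (δ : ℝ) {μ : ℝ} (hμ : (μ : ℂ) ≠ 0) {c a : Label L m}
    (h : a.1.1 ≤ c.1.1) : transitionMatrix L m δ hμ c a = if c = a then 1 else 0 := by
  classical
  obtain ⟨g, hg, hsupp⟩ := fockC_pow_monomial (μ : ℂ) a.1.1 a.1.2
  rw [transitionMatrix, Matrix.of_apply, vermaToFock_basisVec, hg, coeff_add, coeff_monomial]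
  have h0 : coeff (labelExp c) g = 0 := by
    by_contra h1
    exact absurd (hsupp _ h1).1 (not_lt.mpr h)
  rw [h0, add_zero]
  refine if_congr ?_ rfl rfl
  exact ⟨fun e => (labelExp_injective m e).symm, fun e => by rw [e]; rfl⟩

/-- Ordered by degree in `t`, the matrix is block triangular with identity diagonal blocks. -/
theorem det_transitionMatrix (L m : ℕ) (δ : ℝ) {μ : ℝ} (hμ : (μ : ℂ) ≠ 0) :
    (transitionMatrix L m δ hμ).det = 1 := by
  have hT : (transitionMatrix L m δ hμ).BlockTriangular fun a : Label L m => a.1.1 := by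
    intro c a hca
    rw [transitionMatrix_apply_of_le m δ hμ (le_of_lt hca), if_neg]
    rintro rfl
    exact lt_irrefl _ hca
  rw [hT.det]
  refine Finset.prod_eq_one fun n _ => ?_
  have : (transitionMatrix L m δ hμ).toSquareBlock (fun a : Label L m => a.1.1) n = 1 := by
    ext c a
    rw [Matrix.toSquareBlock_def, Matrix.of_apply, transitionMatrix_apply_of_le m δ hμ
      (by rw [c.2, a.2]), Matrix.one_apply]
    exact if_congr Subtype.ext_iff.symm rfl rfl
  rw [this, Matrix.det_one]

theorem pullbackForm_basisVec (δ : ℝ) {μ : ℝ} (hμ : (μ : ℂ) ≠ 0) {m : ℕ} (a b : Label L m) :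
    pullbackForm L δ hμ (basisVec δ μ a) (basisVec δ μ b) =
      ∑ c : Label L m, conj (transitionMatrix L m δ hμ c a) *
        fockNorm L (δ + ((L : ℝ) + 1) ^ 2 / 2) μ (labelExp c) * transitionMatrix L m δ hμ c b := by
  classical
  rw [pullbackForm_apply, fockForm_apply (s := Finset.univ.image (labelExp : Label L m → _)),
    Finset.sum_image fun _ _ _ _ h => labelExp_injective m h]
  · rfl
  -- The image of a basis vector is homogeneous of level `m`, so the labels of level `m` account for
  -- its whole support.
  · intro d hd
    rw [mem_support_iff, vermaToFock_basisVec] at hd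
    obtain ⟨g, hg, hsupp⟩ := fockC_pow_monomial (μ : ℂ) a.1.1 a.1.2
    rw [hg, coeff_add, coeff_monomial] at hd
    rw [Finset.mem_image]
    by_cases h : coeff d g = 0
    · refine ⟨a, Finset.mem_univ a, ?_⟩
      by_contra h1
      rw [h, add_zero] at hd
      exact hd (if_neg h1)
    · obtain ⟨c, hc⟩ := exists_labelExp_eq ((hsupp d h).2.trans (level_labelExp a))
      exact ⟨c, Finset.mem_univ c, hc⟩

/-- The Gram matrix is `Tᴴ * diagonal * T` with `det T = 1`. -/
theorem kacDet_pullbackForm (L m : ℕ) (δ : ℝ) {μ : ℝ} (hμ : (μ : ℂ) ≠ 0) :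
    kacDet (pullbackForm L δ hμ) m =
      ∏ c : Label L m, (fockNorm L (δ + ((L : ℝ) + 1) ^ 2 / 2) μ (labelExp c) : ℂ) := by
  set T := transitionMatrix L m δ hμ with hT
  have h : (Matrix.of fun a b : Label L m =>
      pullbackForm L δ hμ (basisVec δ μ a) (basisVec δ μ b)) =
      T.conjTranspose * Matrix.diagonal (fun c : Label L m =>
        (fockNorm L (δ + ((L : ℝ) + 1) ^ 2 / 2) μ (labelExp c) : ℂ)) * T := by
    ext a b
    rw [Matrix.of_apply, pullbackForm_basisVec, Matrix.mul_apply]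
    refine Finset.sum_congr rfl fun c _ => ?_
    rw [Matrix.mul_diagonal, Matrix.conjTranspose_apply]
    rfl
  rw [kacDet, h, Matrix.det_mul, Matrix.det_mul, Matrix.det_conjTranspose, det_transitionMatrix,
    Matrix.det_diagonal, star_one, one_mul, mul_one]

theorem continuous_fockNorm (L : ℕ) (ν : ℝ) (d : Option (Fin (L + 1)) →₀ ℕ) :
    Continuous fun μ : ℝ => fockNorm L ν μ d := by
  unfold fockNorm
  fun_prop

/-- The entries of the Gram matrix are forced to be `shapovalovFn`, so both sides are continuous in
`μ` and it suffices to compare them for `μ ≠ 0`, where the pullback form can be used. -/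
theorem IsShapovalov.kacDet_eq {δ μ : ℝ} {B : Verma L δ μ →ₗ⋆[ℂ] Verma L δ μ →ₗ[ℂ] ℂ}
    (hB : IsShapovalov B) (m : ℕ) :
    kacDet B m =
      ((∏ c : Label L m, fockNorm L (δ + ((L : ℝ) + 1) ^ 2 / 2) μ (labelExp c) : ℝ) : ℂ) := by
  have key {μ : ℝ} {B : Verma L δ μ →ₗ⋆[ℂ] Verma L δ μ →ₗ[ℂ] ℂ} (hB : IsShapovalov B) :
      kacDet B m = (Matrix.of fun a b : Label L m =>
        shapovalovFn δ (basisWord a) (basisWord b) μ).det := by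
    unfold kacDet
    congr 2
    funext a b
    exact hB.apply_eq (basisWord a) (basisWord b)
  rw [key hB]
  refine eq_of_eq_of_ne_zero
    (g := fun μ => (Matrix.of fun a b : Label L m =>
        shapovalovFn δ (basisWord a) (basisWord b) μ).det)
    (g' := fun μ => ((∏ c : Label L m,
      fockNorm L (δ + ((L : ℝ) + 1) ^ 2 / 2) μ (labelExp c) : ℝ) : ℂ)) ?_ ?_ (fun μ hμ => ?_) μ
  · exact Continuous.matrix_det (continuous_matrix fun a b => continuous_shapovalovFn _ _ _)
  · exact Complex.continuous_ofReal.comp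
      (continuous_finsetProd _ fun c _ => continuous_fockNorm L _ _)
  · have hμ' : (μ : ℂ) ≠ 0 := Complex.ofReal_ne_zero.mpr hμ
    rw [← key (isShapovalov_pullbackForm δ hμ'), kacDet_pullbackForm, Complex.ofReal_prod]

end Determinant

end ConformalGalilei

namespace ConformalGalilei

/-! ### Counting monomials and matching the generating functions. -/

section Counting

variable {L : ℕ}

/-- The exponents of the monomials of level `m`. -/
def levelSet (L m : ℕ) : Finset (Option (Fin (L + 1)) →₀ ℕ) :=
  (Finset.univ : Finset (Label L m)).map ⟨labelExp, labelExp_injective m⟩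

theorem mem_levelSet {m : ℕ} {d : Option (Fin (L + 1)) →₀ ℕ} : d ∈ levelSet L m ↔ level d = m := by
  rw [levelSet, Finset.mem_map]
  constructor
  · rintro ⟨a, _, rfl⟩
    exact level_labelExp a
  · intro h
    obtain ⟨a, ha⟩ := exists_labelExp_eq h
    exact ⟨a, Finset.mem_univ a, ha⟩

theorem dSeries_eq (L : ℕ) :
    dSeries L = ∏ o : Option (Fin (L + 1)), geomSeries (varLevel o) := by
  rw [dSeries, Fintype.prod_option, Finset.prod_range]
  rfl

theorem varLevel_pos (o : Option (Fin (L + 1))) : 0 < varLevel o := by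
  cases o <;> simp [varLevel]

theorem dNum_eq_card (L m : ℕ) : dNum L m = (levelSet L m).card := by
  classical
  rw [dNum, dSeries_eq, PowerSeries.coeff_prod]
  have h (l : Option (Fin (L + 1)) →₀ ℕ) :
      ∏ o, PowerSeries.coeff (l o) (geomSeries (varLevel o)) =
        if ∀ o, varLevel o ∣ l o then 1 else 0 := by
    simp only [geomSeries, PowerSeries.coeff_mk]
    rw [Finset.prod_ite_zero]
    simp
  rw [Finset.sum_congr rfl fun l _ => h l, ← Finset.sum_filter, ← Finset.card_eq_sum_ones]
  -- In the product of geometric series the index `l o` is the contribution of the variable `o` to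
  -- the level, that is, `varLevel o` times its exponent.
  refine Finset.card_nbij'
    (fun l => Finsupp.equivFunOnFinite.symm fun o => l o / varLevel o)
    (fun d => Finsupp.equivFunOnFinite.symm fun o => varLevel o * d o) ?_ ?_ ?_ ?_
  · intro l hl
    rw [Finset.mem_coe, Finset.mem_filter, Finset.mem_finsuppAntidiag] at hl
    rw [Finset.mem_coe, mem_levelSet, level, ← hl.1.1]
    exact Finset.sum_congr rfl fun o _ => Nat.mul_div_cancel' (hl.2 o)
  · intro d hd
    rw [Finset.mem_coe, mem_levelSet] at hd
    rw [Finset.mem_coe, Finset.mem_filter, Finset.mem_finsuppAntidiag]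
    exact ⟨⟨hd, Finset.subset_univ _⟩, fun o => Dvd.intro _ rfl⟩
  · intro l hl
    rw [Finset.mem_coe, Finset.mem_filter] at hl
    ext o
    exact Nat.mul_div_cancel' (hl.2 o)
  · intro d _
    ext o
    exact Nat.mul_div_cancel_left _ (varLevel_pos o)

theorem varLevel_mul_le (d : Option (Fin (L + 1)) →₀ ℕ) (o : Option (Fin (L + 1))) :
    varLevel o * d o ≤ level d :=
  Finset.single_le_sum (f := fun o => varLevel o * d o) (fun _ _ => Nat.zero_le _)
    (Finset.mem_univ o)

/-- The number of monomials of level `m` that are divisible by a power of a given variable. -/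
theorem card_filter_levelSet (o : Option (Fin (L + 1))) (m r : ℕ) :
    ((levelSet L m).filter fun d => r < d o).card =
      if varLevel o * (r + 1) ≤ m then dNum L (m - varLevel o * (r + 1)) else 0 := by
  split_ifs with h
  · rw [dNum_eq_card]
    refine Finset.card_nbij' (fun d => d - Finsupp.single o (r + 1))
      (fun d => d + Finsupp.single o (r + 1)) ?_ ?_ ?_ ?_
    · intro d hd
      rw [Finset.mem_coe, Finset.mem_filter, mem_levelSet] at hd
      rw [Finset.mem_coe, mem_levelSet]
      have h1 : d - Finsupp.single o (r + 1) + Finsupp.single o (r + 1) = d :=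
        tsub_add_cancel_of_le (by rw [Finsupp.single_le_iff]; exact hd.2)
      have h2 := level_add (d - Finsupp.single o (r + 1)) (Finsupp.single o (r + 1))
      rw [h1, level_single, hd.1] at h2
      exact (Nat.sub_eq_of_eq_add h2).symm
    · intro d hd
      rw [Finset.mem_coe, mem_levelSet] at hd
      rw [Finset.mem_coe, Finset.mem_filter, mem_levelSet, level_add, level_single, hd]
      refine ⟨by omega, ?_⟩
      rw [Finsupp.add_apply, Finsupp.single_eq_same]
      omega
    · intro d hd
      rw [Finset.mem_coe, Finset.mem_filter] at hd
      exact tsub_add_cancel_of_le (by rw [Finsupp.single_le_iff]; exact hd.2)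
    · intro d _
      exact add_tsub_cancel_right d _
  · rw [Finset.card_eq_zero, Finset.filter_eq_empty_iff]
    intro d hd hr
    rw [mem_levelSet] at hd
    have h1 := varLevel_mul_le d o
    have h2 : varLevel o * (r + 1) ≤ varLevel o * d o := Nat.mul_le_mul_left _ hr
    omega

/-- An exponent is the number of `r` below it; the order of summation is then exchanged. The level
bounds the exponents by `m`. -/
theorem sum_levelSet_apply (o : Option (Fin (L + 1))) (m : ℕ) :
    ∑ d ∈ levelSet L m, d o =
      ∑ r ∈ Finset.range m, ((levelSet L m).filter fun d => r < d o).card := by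
  simp only [Finset.card_filter]
  rw [Finset.sum_comm]
  refine Finset.sum_congr rfl fun d hd => ?_
  rw [mem_levelSet] at hd
  have h1 : d o ≤ m := by
    have := varLevel_mul_le d o
    have := Nat.le_mul_of_pos_left (d o) (varLevel_pos o)
    omega
  rw [← Finset.card_filter]
  have h2 : (Finset.range m).filter (fun r => r < d o) = Finset.range (d o) := by
    ext r
    rw [Finset.mem_filter, Finset.mem_range, Finset.mem_range]
    omega
  rw [h2, Finset.card_range]

theorem coeff_X_pow_mul_geomSeries {w : ℕ} (hw : 0 < w) (n : ℕ) :
    PowerSeries.coeff n (PowerSeries.X ^ w * geomSeries w) = if w ∣ n ∧ 0 < n then 1 else 0 := by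
  rw [PowerSeries.coeff_X_pow_mul', geomSeries]
  split_ifs with h1 h2 h2
  · rw [PowerSeries.coeff_mk, if_pos ((Nat.dvd_sub_iff_left h1 dvd_rfl).mpr h2.1)]
  · rw [PowerSeries.coeff_mk, if_neg]
    intro h3
    exact h2 ⟨(Nat.dvd_sub_iff_left h1 dvd_rfl).mp h3, by omega⟩
  · exact absurd (Nat.le_of_dvd h2.2 h2.1) h1
  · rfl

/-- With `w = varLevel o`, the monomials divisible by the `(r + 1)`-st power of the variable are
counted by `d_{m - w(r+1)}`; summing over `r` is convolution with `x^w / (1 - x^w)`. -/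
theorem sum_levelSet_eq_coeff (o : Option (Fin (L + 1))) (m : ℕ) :
    ∑ d ∈ levelSet L m, d o = PowerSeries.coeff m
      (PowerSeries.X ^ varLevel o * geomSeries (varLevel o) * dSeries L) := by
  have hw := varLevel_pos o
  rw [sum_levelSet_apply, PowerSeries.coeff_mul, Finset.Nat.sum_antidiagonal_eq_sum_range_succ
    (fun i j => PowerSeries.coeff i (PowerSeries.X ^ varLevel o * geomSeries (varLevel o)) *
      PowerSeries.coeff j (dSeries L))]
  simp only [coeff_X_pow_mul_geomSeries hw, card_filter_levelSet, ite_mul, one_mul, zero_mul]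
  rw [← Finset.sum_filter, ← Finset.sum_filter]
  refine Finset.sum_nbij' (fun r => varLevel o * (r + 1)) (fun n => n / varLevel o - 1)
    ?_ ?_ ?_ ?_ ?_
  · intro r hr
    rw [Finset.mem_filter, Finset.mem_range] at hr
    rw [Finset.mem_filter, Finset.mem_range]
    exact ⟨by omega, Dvd.intro _ rfl, by positivity⟩
  · intro n hn
    rw [Finset.mem_filter, Finset.mem_range] at hn
    rw [Finset.mem_filter, Finset.mem_range]
    obtain ⟨h1, ⟨c, rfl⟩, h3⟩ := hn
    have hc : 0 < c := Nat.pos_of_mul_pos_left h3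
    have := Nat.le_mul_of_pos_left c hw
    rw [Nat.mul_div_cancel_left _ hw, Nat.sub_add_cancel hc]
    omega
  · intro r _
    rw [Nat.mul_div_cancel_left _ hw, Nat.add_sub_cancel]
  · intro n hn
    rw [Finset.mem_filter] at hn
    obtain ⟨_, ⟨c, rfl⟩, h3⟩ := hn
    have hc : 0 < c := Nat.pos_of_mul_pos_left h3
    rw [Nat.mul_div_cancel_left _ hw, Nat.sub_add_cancel hc]
  · intro r _
    rfl

/-- Each factor `x_j` of a monomial puts one `μ` into its norm, so the total degree in the `x_j` is
the exponent of `μ`. -/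
theorem sum_levelSet_eq_eNum (L m : ℕ) :
    ∑ d ∈ levelSet L m, ∑ j : Fin (L + 1), d (some j) = eNum L m := by
  rw [Finset.sum_comm, eNum, eSeries, ← dSeries, Finset.sum_mul, map_sum, Finset.sum_range]
  exact Finset.sum_congr rfl fun j _ => sum_levelSet_eq_coeff (some j) m

theorem coeff_geomSeries_one_mul (f : PowerSeries ℕ) (n : ℕ) :
    PowerSeries.coeff n (geomSeries 1 * f) =
      ∑ q ∈ Finset.range (n + 1), PowerSeries.coeff q f := by
  rw [mul_comm, PowerSeries.coeff_mul, Finset.Nat.sum_antidiagonal_eq_sum_range_succ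
    (fun i j => PowerSeries.coeff i f * PowerSeries.coeff j (geomSeries 1))]
  refine Finset.sum_congr rfl fun q _ => ?_
  rw [geomSeries, PowerSeries.coeff_mk, if_pos (one_dvd _), mul_one]

theorem dNum_zero (n : ℕ) : dNum 0 n = n / 2 + 1 := by
  rw [dNum, dSeries, Finset.prod_range_one, mul_comm]
  rw [show 2 * 0 + 1 = 1 from rfl, coeff_geomSeries_one_mul]
  induction n with
  | zero => simp [geomSeries, Finset.filter_singleton]
  | succ n ih =>
    rw [Finset.sum_range_succ, ih, geomSeries, PowerSeries.coeff_mk]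
    split_ifs with h <;> omega

theorem sum_range_half (m : ℕ) :
    ∑ q ∈ Finset.range m, (q / 2 + 1) = (m - m / 2) * (m / 2 + 1) := by
  induction m with
  | zero => rfl
  | succ m ih =>
    rw [Finset.sum_range_succ, ih]
    rcases Nat.even_or_odd' m with ⟨k, rfl | rfl⟩
    · rw [show 2 * k - 2 * k / 2 = k by omega, show 2 * k / 2 = k by omega,
        show (2 * k + 1) / 2 = k by omega, show 2 * k + 1 - k = k + 1 by omega]
      ring
    · rw [show (2 * k + 1) / 2 = k by omega, show 2 * k + 1 - k = k + 1 by omega,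
        show (2 * k + 1 + 1) / 2 = k + 1 by omega, show 2 * k + 1 + 1 - (k + 1) = k + 1 by omega]
      ring

theorem eNum_zero (m : ℕ) : eNum 0 m = (m - m / 2) * (m / 2 + 1) := by
  rw [eNum, eSeries, ← dSeries, Finset.sum_range_one, show 2 * 0 + 1 = 1 from rfl, mul_assoc,
    pow_one]
  cases m with
  | zero => simp
  | succ m =>
    rw [PowerSeries.coeff_succ_X_mul, coeff_geomSeries_one_mul, ← sum_range_half]
    exact Finset.sum_congr rfl fun q _ => dNum_zero q

end Counting

/-! ### Collecting the factors of the product of norms. -/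

/-- The constant factor of the Kac determinant. -/
def kacConst (L m : ℕ) : ℝ :=
  ∏ d ∈ levelSet L m, ((∏ i ∈ Finset.range (d none), (-((i : ℝ) + 1) / 2)) *
    ∏ j : Fin (L + 1), ((d (some j)).factorial * realI L (L - j) ^ d (some j)))

theorem kacConst_ne_zero (L m : ℕ) : kacConst L m ≠ 0 := by
  refine Finset.prod_ne_zero_iff.mpr fun d _ => mul_ne_zero ?_ ?_
  · refine Finset.prod_ne_zero_iff.mpr fun i _ => ?_
    have : (0 : ℝ) < (i : ℝ) + 1 := by positivity
    exact div_ne_zero (neg_ne_zero.mpr this.ne') two_ne_zero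
  · refine Finset.prod_ne_zero_iff.mpr fun j _ => mul_ne_zero ?_ (pow_ne_zero _ (realI_ne_zero _ _))
    exact_mod_cast Nat.factorial_ne_zero _

/-- The factor `F i` occurs once for each monomial divisible by `t^(i+1)`, and dividing by that
power leaves an arbitrary monomial of level `m - 2(i+1)`. -/
theorem prod_levelSet_prod_range (L m : ℕ) (F : ℕ → ℝ) :
    ∏ d ∈ levelSet L m, ∏ i ∈ Finset.range (d none), F i =
      ∏ i ∈ Finset.range (m / 2), F i ^ dNum L (m - 2 * (i + 1)) := by
  have h1 : ∀ d ∈ levelSet L m, ∏ i ∈ Finset.range (d none), F i =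
      ∏ i ∈ Finset.range (m / 2), if i < d none then F i else 1 := by
    intro d hd
    rw [mem_levelSet] at hd
    have h2 : 2 * d none ≤ level d := varLevel_mul_le d none
    rw [← Finset.prod_filter]
    congr 1
    ext i
    rw [Finset.mem_filter, Finset.mem_range, Finset.mem_range]
    omega
  rw [Finset.prod_congr rfl h1, Finset.prod_comm]
  refine Finset.prod_congr rfl fun i hi => ?_
  rw [Finset.mem_range] at hi
  rw [← Finset.prod_filter, Finset.prod_const, card_filter_levelSet, if_pos]
  · rfl
  · change 2 * (i + 1) ≤ m
    omega

theorem prod_fockNorm (L m : ℕ) (δ μ : ℝ) :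
    ∏ c : Label L m, fockNorm L (δ + ((L : ℝ) + 1) ^ 2 / 2) μ (labelExp c) =
      kacConst L m * μ ^ eNum L m * ∏ j ∈ Finset.range (m / 2),
        (2 * δ - 2 * (j : ℝ) + (spin L + 1 / 2) ^ 2) ^ dNum L (m - 2 * (j + 1)) := by
  have h : ∏ c : Label L m, fockNorm L (δ + ((L : ℝ) + 1) ^ 2 / 2) μ (labelExp c) =
      ∏ d ∈ levelSet L m, fockNorm L (δ + ((L : ℝ) + 1) ^ 2 / 2) μ d := by
    rw [levelSet, Finset.prod_map]
    rfl
  rw [h, ← prod_levelSet_prod_range, kacConst, ← sum_levelSet_eq_eNum, ← Finset.prod_pow_eq_pow_sum,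
    ← Finset.prod_mul_distrib, ← Finset.prod_mul_distrib]
  refine Finset.prod_congr rfl fun d _ => ?_
  have h1 : ∏ j : Fin (L + 1), ((d (some j)).factorial * (realI L (L - j) * μ) ^ d (some j)) =
      (∏ j : Fin (L + 1), ((d (some j)).factorial * realI L (L - j) ^ d (some j))) *
        μ ^ ∑ j : Fin (L + 1), d (some j) := by
    rw [← Finset.prod_pow_eq_pow_sum, ← Finset.prod_mul_distrib]
    exact Finset.prod_congr rfl fun j _ => by rw [mul_pow, mul_assoc]
  -- Each factor `δ + (L + 1)² / 2 - i` is half of a factor of the stated formula, as `ℓ + 1/2 = L +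
  -- 1`; the halves go into `kacConst`.
  have h2 : ∏ i ∈ Finset.range (d none),
      (-((i : ℝ) + 1) * (δ + ((L : ℝ) + 1) ^ 2 / 2 - i)) =
      (∏ i ∈ Finset.range (d none), (-((i : ℝ) + 1) / 2)) *
        ∏ i ∈ Finset.range (d none), (2 * δ - 2 * (i : ℝ) + (spin L + 1 / 2) ^ 2) := by
    rw [← Finset.prod_mul_distrib]
    exact Finset.prod_congr rfl fun i _ => by rw [spin]; ring
  rw [fockNorm, h1, h2]
  ring

end ConformalGalilei

end


theorem theorem13 (m : ℕ) :
    (∀ L : ℕ, ∃ c : ℝ, c ≠ 0 ∧ ∀ δ μ : ℝ,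
      (∃ B : Verma L δ μ →ₗ⋆[ℂ] Verma L δ μ →ₗ[ℂ] ℂ, IsShapovalov B) ∧
      ∀ B : Verma L δ μ →ₗ⋆[ℂ] Verma L δ μ →ₗ[ℂ] ℂ, IsShapovalov B →
        kacDet B m =
          ((c * μ ^ eNum L m *
            ∏ j ∈ Finset.range (m / 2),
              (2 * δ - 2 * (j : ℝ) + (spin L + 1 / 2) ^ 2) ^ dNum L (m - 2 * (j + 1)) : ℝ) : ℂ)) ∧
    (∃ c : ℝ, c ≠ 0 ∧ ∀ δ μ : ℝ,
      ∀ B : Verma 0 δ μ →ₗ⋆[ℂ] Verma 0 δ μ →ₗ[ℂ] ℂ, IsShapovalov B →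
        kacDet B m =
          ((c * μ ^ ((m - m / 2) * (m / 2 + 1)) *
            ∏ j ∈ Finset.range (m / 2),
              (2 * δ - 2 * (j : ℝ) + 1) ^ (m / 2 - j) : ℝ) : ℂ)) := by
  refine ⟨fun L => ⟨kacConst L m, kacConst_ne_zero L m, fun δ μ => ⟨exists_isShapovalov L δ μ,
    fun B hB => ?_⟩⟩, kacConst 0 m, kacConst_ne_zero 0 m, fun δ μ B hB => ?_⟩
  · rw [hB.kacDet_eq, prod_fockNorm]
  · rw [hB.kacDet_eq, prod_fockNorm, eNum_zero]
    congr 2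
    refine Finset.prod_congr rfl fun j hj => ?_
    rw [Finset.mem_range] at hj
    -- The bound `j < m / 2` ensures `2 * (j + 1) ≤ m`, so the subtraction is not truncated.
    rw [dNum_zero, show (m - 2 * (j + 1)) / 2 + 1 = m / 2 - j by omega, spin]
    norm_num
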